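/- Let $n\ge 1$ and $w\in S_n$; permutations multiply by composition, and $t_{i,j}$ denotes the transposition of $i$ and $j$. Cells of the $n\times n$ grid are written $(\text{row},\text{column})$, with row $1$ at the top and column $1$ at the left. The Rothe diagram of $w$ is $D(w)=\{(i,j)\in[n]\times[n] : w(i)>j,\ w^{-1}(j)>i\}$, and a lower outside corner of $D(w)$ is an element $(a,b)\in D(w)$ that is maximally southeast, i.e. no other $(i,j)\in D(w)$ satisfies $i\ge a$ and $j\ge b$. Let $\ell(w)=\#\{(i,j): i<j,\ w(i)>w(j)\}$, and let $<$ be the strong Bruhat order on $S_n$, i.e. the transitive closure of the relations $w<wt_{i,j}$ with $\ell(wt_{i,j})=\ell(w)+1$. A bumpless pipe dream (BPD) is a tiling of the $n\times n$ grid by the following six tiles: the elbow joining the bottom and right sides of the cell, the elbow joining the left and top sides, the crossing of a horizontal and a vertical strand, the blank tile, the horizontal strand and the vertical strand; such that there are $n$ pipes in total, the pipes start at the bottom edge of the grid and end at its right edge, and any two pipes cross at most once. Label the pipes $1,\dots,n$ from left to right by their starting columns. For $w\in S_n$, $\mathsf{BPD}(w)$ is the set of BPDs in which, for every $i\in[n]$,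 the pipe that terminates in row $i$ has label $w(i)$. The diagram $D(\mathcal B)$ of a BPD $\mathcal B$ is the set of cells $(i,j)$ that contain a blank tile. Let $(a,b)$ be a lower outside corner of $D(w)$, put $v=w\,t_{a,w^{-1}(b)}$, and let \[ \Phi(w,z_{a,b})=\{v\,t_{i,a} : 1\le i<a,\ v\,t_{i,a}>v,\ \ell(v\,t_{i,a})=\ell(v)+1\}. \] Then there is a bijection \[ \psi:\ \mathsf{BPD}(w)\ \longrightarrow\ \mathsf{BPD}(v)\ \cup\bigcup_{u\in\Phi(w,z_{a,b})}\mathsf{BPD}(u) \] such that, for every $\mathcal B\in\mathsf{BPD}(w)$: if $\psi(\mathcal B)\in\mathsf{BPD}(v)$, then $D(\mathcal B)=D(\psi(\mathcal B))\sqcup\{(a,b)\}$ (a disjoint union); otherwise $D(\mathcal B)=D(\psi(\mathcal B))$. -/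

import Mathlib

/-! Rows and columns of the `n × n` grid are indexed by `Fin n`; row `0` is the top row and
column `0` the leftmost column. Permutations multiply by composition,
`(w * Equiv.swap i j) k = w (Equiv.swap i j k)`. -/

namespace Bumpless

/-- The Rothe diagram `D(w)`. -/
def rotheDiagram {n : ℕ} (w : Equiv.Perm (Fin n)) : Set (Fin n × Fin n) :=
  {p | p.2 < w p.1 ∧ p.1 < w⁻¹ p.2}

/-- A lower outside corner: a maximally southeast cell of `D(w)`, that is, a maximal element
of `D(w)` for the componentwise order on cells. -/
def IsLowerOutsideCorner {n : ℕ} (w : Equiv.Perm (Fin n)) (a b : Fin n) : Prop :=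
  Maximal (fun p : Fin n × Fin n => p ∈ rotheDiagram w) (a, b)

/-- The Coxeter length: the number of inversions. -/
def coxeterLength {n : ℕ} (w : Equiv.Perm (Fin n)) : ℕ :=
  (Finset.univ.filter (fun p : Fin n × Fin n => p.1 < p.2 ∧ w p.2 < w p.1)).card

/-- The covering relation of the strong Bruhat order. -/
def BruhatCovers {n : ℕ} (w u : Equiv.Perm (Fin n)) : Prop :=
  ∃ i j : Fin n, u = w * Equiv.swap i j ∧ coxeterLength w + 1 = coxeterLength u

/-- The strict strong Bruhat order `w < u`. -/
def BruhatLT {n : ℕ} (w u : Equiv.Perm (Fin n)) : Prop :=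
  Relation.TransGen BruhatCovers w u

/-- `v = w t_{a, w⁻¹(b)}`. -/
def cornerSwap {n : ℕ} (w : Equiv.Perm (Fin n)) (a b : Fin n) : Equiv.Perm (Fin n) :=
  w * Equiv.swap a (w⁻¹ b)

/-- The set `φ(w, z_{a,b})` of rows. -/
def phi {n : ℕ} (w : Equiv.Perm (Fin n)) (a b : Fin n) : Set (Fin n) :=
  {i | i < a ∧ BruhatLT (cornerSwap w a b) (cornerSwap w a b * Equiv.swap i a) ∧
    coxeterLength (cornerSwap w a b * Equiv.swap i a) =
      coxeterLength (cornerSwap w a b) + 1}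

/-- The set `Φ(w, z_{a,b})` of permutations. -/
def Phi {n : ℕ} (w : Equiv.Perm (Fin n)) (a b : Fin n) : Set (Equiv.Perm (Fin n)) :=
  {u | ∃ i ∈ phi w a b, u = cornerSwap w a b * Equiv.swap i a}

/-- The six tiles. `downElbow` joins the bottom and right sides of its cell, `upElbow` joins
the left and top sides, `cross` has a horizontal and a vertical strand. -/
inductive Tile
  | downElbow
  | upElbow
  | cross
  | blank
  | horizontal
  | vertical

/-- Pipes are followed from the bottom edge of the grid, so they move north or east. -/
inductive Heading
  | north
  | east

/-- `t.Carries h h'`: a strand of `t` that is entered with heading `h` (from below for `north`,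
from the left for `east`) is left with heading `h'` (upwards, respectively to the right). -/
inductive Tile.Carries : Tile → Heading → Heading → Prop
  | downElbow : Tile.Carries .downElbow .north .east
  | upElbow : Tile.Carries .upElbow .east .north
  | crossNorth : Tile.Carries .cross .north .north
  | crossEast : Tile.Carries .cross .east .east
  | horizontal : Tile.Carries .horizontal .east .east
  | vertical : Tile.Carries .vertical .north .north

/-- A strand of the tile meets the side (bottom, left) through which heading `h` enters. -/
def Tile.HasEntry (t : Tile) (h : Heading) : Prop := ∃ h', t.Carries h h'

/-- A strand of the tile meets the side (top, right) through which heading `h` leaves. -/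
def Tile.HasExit (t : Tile) (h : Heading) : Prop := ∃ h', t.Carries h' h

/-- Tilings of the `n × n` grid, `B i j` being the tile in row `i` and column `j`. -/
abbrev Tiling (n : ℕ) := Fin n → Fin n → Tile

/-- The pipe that starts at the bottom edge of column `k` enters the cell `(i, j)` with
heading `h`. -/
inductive Enters {n : ℕ} (B : Tiling n) (k : Fin n) : Heading → Fin n → Fin n → Prop
  | start (i : Fin n) : i.val + 1 = n → Enters B k .north i k
  | north (h : Heading) (i i' j : Fin n) : Enters B k h i j → (B i j).Carries h .north →
      i'.val + 1 = i.val → Enters B k .north i' j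
  | east (h : Heading) (i j j' : Fin n) : Enters B k h i j → (B i j).Carries h .east →
      j'.val = j.val + 1 → Enters B k .east i j'

/-- The pipe that starts in column `k` terminates at the right edge of the grid in row `i`. -/
def Terminates {n : ℕ} (B : Tiling n) (k i : Fin n) : Prop :=
  ∃ (h : Heading) (j : Fin n), j.val + 1 = n ∧ Enters B k h i j ∧ (B i j).Carries h .east

/-- The pipes that start in columns `k` and `l` cross in the cell `(i, j)`. -/
def CrossAt {n : ℕ} (B : Tiling n) (k l i j : Fin n) : Prop :=
  B i j = .cross ∧
    ((Enters B k .north i j ∧ Enters B l .east i j) ∨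
      (Enters B k .east i j ∧ Enters B l .north i j))

/-- Bumpless pipe dreams. The first six conditions say that the strands join up to `n` pipes,
each leading from the bottom edge of the grid to its right edge. -/
structure IsBPD {n : ℕ} (B : Tiling n) : Prop where
  joinVertical : ∀ i i' j : Fin n, i'.val = i.val + 1 →
    ((B i j).HasEntry .north ↔ (B i' j).HasExit .north)
  joinHorizontal : ∀ i j j' : Fin n, j'.val = j.val + 1 →
    ((B i j).HasExit .east ↔ (B i j').HasEntry .east)
  bottomEdge : ∀ i j : Fin n, i.val + 1 = n → (B i j).HasEntry .north
  rightEdge : ∀ i j : Fin n, j.val + 1 = n → (B i j).HasExit .east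
  topEdge : ∀ i j : Fin n, i.val = 0 → ¬ (B i j).HasExit .north
  leftEdge : ∀ i j : Fin n, j.val = 0 → ¬ (B i j).HasEntry .east
  crossOnce : ∀ k l : Fin n, k ≠ l → ∀ i j i' j' : Fin n,
    CrossAt B k l i j → CrossAt B k l i' j' → i = i' ∧ j = j'

/-- `BPD(w)`: the bumpless pipe dreams in which, for every row `i`, the pipe that terminates
in row `i` is the one that starts in column `w i`. -/
def BPD {n : ℕ} (w : Equiv.Perm (Fin n)) : Set (Tiling n) :=
  {B | IsBPD B ∧ ∀ i : Fin n, Terminates B (w i) i}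

/-- The diagram `D(B)`: the set of cells with a blank tile. -/
def diagram {n : ℕ} (B : Tiling n) : Set (Fin n × Fin n) :=
  {p | B p.1 p.2 = .blank}

end Bumpless

namespace Bumpless

/-! The proof shows that everything weakly southeast of `(a, b)` is forced, so that the bijection
only changes the corner tile. If no up-elbow lies elsewhere weakly southeast of a cell, a blank or
up-elbow in that cell forces the cell into the Rothe diagram. As `(a, b)` is the only cell of `D(w)`
in this region, every pipe dream of `w` agrees there with the Rothe pipe dream, whose pipes are
hooks, except that the corner tile is blank or an up-elbow (`IsJoined.isStandard`,
`IsCorner.corner_w`). For `v` and for `u ∈ Φ` the region contains no Rothe cell, so the corner is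
forced as well: a down-elbow for `v`, a crossing for `u`. The bijection keeps the outside, replaces
blank by down-elbow and up-elbow by crossing, and refills the rest of the region; the fillings for
`v` and `u` coincide off the corner.

In the blank case the pipes `b` and `w a` exchange their rows `a` and `c = w⁻¹ b`. In the up-elbow
case the pipe `w i` that turned north at the corner now runs on along row `a`, and pipe `b` takes
over its former path above; rows `i`, `a`, `c` then carry `b`, `w i`, `w a`, which is `v t_{i,a}`.

It remains to exclude double crossings (`IsSurgery.isBPD`). Only a pair that crosses once to the
left of the region and once above it can cause trouble, when one of the two pipes is relabelled
above. From `w` to `u` this is harmless, since pipe `b` never visits the columns left of `b`. From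
`u` to `w`, crossing pipes are inverted (`CrossAt.inv_lt`), so such a second pipe `w m` would
satisfy `i < m < a` and `w i < w m < b`, which the length condition forbids
(`coxeterLength_mul_swap_eq_succ_iff`). Conversely, in a pipe dream of `w` with an up-elbow at the
corner, such a pipe `w m` could not cross `w i` and would be trapped in the region
(`not_between_of_upElbow`). -/

/-- The tilings whose strands join up to pipes from the bottom edge to the right edge; two pipes
may cross more than once. -/
structure IsJoined {n : ℕ} (B : Tiling n) : Prop where
  joinVertical : ∀ i i' j : Fin n, i'.val = i.val + 1 →
    ((B i j).HasEntry .north ↔ (B i' j).HasExit .north)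
  joinHorizontal : ∀ i j j' : Fin n, j'.val = j.val + 1 →
    ((B i j).HasExit .east ↔ (B i j').HasEntry .east)
  bottomEdge : ∀ i j : Fin n, i.val + 1 = n → (B i j).HasEntry .north
  rightEdge : ∀ i j : Fin n, j.val + 1 = n → (B i j).HasExit .east
  topEdge : ∀ i j : Fin n, i.val = 0 → ¬ (B i j).HasExit .north
  leftEdge : ∀ i j : Fin n, j.val = 0 → ¬ (B i j).HasEntry .east

theorem IsBPD.isJoined {n : ℕ} {B : Tiling n} (h : IsBPD B) : IsJoined B :=
  ⟨h.joinVertical, h.joinHorizontal, h.bottomEdge, h.rightEdge, h.topEdge, h.leftEdge⟩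

/-! ### Strands of a single tile -/

theorem Tile.Carries.exit_unique {t : Tile} {h g g' : Heading} (H : t.Carries h g)
    (H' : t.Carries h g') : g = g' := by
  cases H <;> cases H' <;> rfl

theorem Tile.Carries.entry_unique {t : Tile} {h h' g : Heading} (H : t.Carries h g)
    (H' : t.Carries h' g) : h = h' := by
  cases H <;> cases H' <;> rfl

theorem Tile.hasEntry_north {t : Tile} :
    t.HasEntry .north ↔ t = .downElbow ∨ t = .cross ∨ t = .vertical := by
  constructor
  · rintro ⟨_, H⟩; cases H <;> simp
  · rintro (rfl | rfl | rfl)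
    exacts [⟨_, .downElbow⟩, ⟨_, .crossNorth⟩, ⟨_, .vertical⟩]

theorem Tile.hasEntry_east {t : Tile} :
    t.HasEntry .east ↔ t = .upElbow ∨ t = .cross ∨ t = .horizontal := by
  constructor
  · rintro ⟨_, H⟩; cases H <;> simp
  · rintro (rfl | rfl | rfl)
    exacts [⟨_, .upElbow⟩, ⟨_, .crossEast⟩, ⟨_, .horizontal⟩]

theorem Tile.hasExit_north {t : Tile} :
    t.HasExit .north ↔ t = .upElbow ∨ t = .cross ∨ t = .vertical := by
  constructor
  · rintro ⟨_, H⟩; cases H <;> simp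
  · rintro (rfl | rfl | rfl)
    exacts [⟨_, .upElbow⟩, ⟨_, .crossNorth⟩, ⟨_, .vertical⟩]

theorem Tile.hasExit_east {t : Tile} :
    t.HasExit .east ↔ t = .downElbow ∨ t = .cross ∨ t = .horizontal := by
  constructor
  · rintro ⟨_, H⟩; cases H <;> simp
  · rintro (rfl | rfl | rfl)
    exacts [⟨_, .downElbow⟩, ⟨_, .crossEast⟩, ⟨_, .horizontal⟩]

theorem Tile.carries_east_east {t : Tile} (h : t.HasEntry .east) (h' : t.HasExit .east) :
    t.Carries .east .east := by
  rw [Tile.hasEntry_east] at h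
  rw [Tile.hasExit_east] at h'
  rcases h with rfl | rfl | rfl
  · simp at h'
  · exact .crossEast
  · exact .horizontal

theorem Tile.carries_north_north {t : Tile} (h : t.HasEntry .north) (h' : t.HasExit .north) :
    t.Carries .north .north := by
  rw [Tile.hasEntry_north] at h
  rw [Tile.hasExit_north] at h'
  rcases h with rfl | rfl | rfl
  · simp at h'
  · exact .crossNorth
  · exact .vertical

/-! ### Pipes as lattice paths, parametrized by diagonals -/

section Paths

variable {n : ℕ} {B : Tiling n} {k l : Fin n} {h h' g : Heading} {i i' j j' : Fin n}

theorem Enters.start_le (H : Enters B k h i j) : k ≤ j := by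
  induction H with
  | start => exact le_rfl
  | north _ _ _ _ _ _ _ ih => exact ih
  | east _ _ j j' _ _ e ih =>
    rw [Fin.le_def] at *; omega

theorem Enters.start_lt_of_east (H : Enters B k .east i j) : k < j := by
  cases H with
  | east h _ j _ H _ e =>
    have := H.start_le
    rw [Fin.le_def] at this
    rw [Fin.lt_def]; omega

/-- On each diagonal of the grid a pipe enters at most one cell, with one heading. -/
theorem Enters.unique (H : Enters B k h i j) : ∀ {h' : Heading} {i' j' : Fin n},
    Enters B k h' i' j' → (j : ℤ) - i = j' - i' → h = h' ∧ i = i' ∧ j = j' := by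
  induction H with
  | start i hi =>
    intro h' i' j' H' e
    cases H' with
    | start _ hi' => exact ⟨rfl, Fin.ext (by omega), rfl⟩
    | north _ i₀ _ _ H₀ _ e' =>
      have h₁ := Fin.le_def.1 H₀.start_le
      have := i₀.2
      omega
    | east _ _ j₀ _ H₀ _ e' =>
      have h₁ := Fin.le_def.1 H₀.start_le
      have := i'.2
      omega
  | north h₁ i₁ i₂ j₁ H₁ c₁ e₁ ih =>
    intro h' i' j' H' e
    cases H' with
    | start _ hi' =>
      have h₁ := Fin.le_def.1 H₁.start_le
      have := i₁.2
      omega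
    | north _ i₀ _ _ H₀ c₀ e' =>
      obtain ⟨rfl, rfl, rfl⟩ := ih H₀ (by omega)
      exact ⟨rfl, Fin.ext (by omega), rfl⟩
    | east _ _ j₀ _ H₀ c₀ e' =>
      obtain ⟨rfl, rfl, rfl⟩ := ih H₀ (by omega)
      exact absurd (c₁.exit_unique c₀) (by simp)
  | east h₁ i₁ j₁ j₂ H₁ c₁ e₁ ih =>
    intro h' i' j' H' e
    cases H' with
    | start _ hi' =>
      have h₁ := Fin.le_def.1 H₁.start_le
      have := i₁.2
      omega
    | north _ i₀ _ _ H₀ c₀ e' =>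
      obtain ⟨rfl, rfl, rfl⟩ := ih H₀ (by omega)
      exact absurd (c₁.exit_unique c₀) (by simp)
    | east _ _ j₀ _ H₀ c₀ e' =>
      obtain ⟨rfl, rfl, rfl⟩ := ih H₀ (by omega)
      exact ⟨rfl, rfl, Fin.ext (by omega)⟩

/-- A pipe visits every diagonal between its start and any cell on it. -/
theorem Enters.exists_on_diagonal (H : Enters B k h i j) (t : ℤ) (h₀ : (k : ℤ) - (n - 1) ≤ t)
    (h₁ : t ≤ (j : ℤ) - i) : ∃ h' i' j', Enters B k h' i' j' ∧ (j' : ℤ) - i' = t := by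
  induction H with
  | start i hi => exact ⟨_, _, _, .start i hi, by omega⟩
  | north h₂ i₂ i₃ j₂ H₂ c₂ e₂ ih =>
    rcases h₁.eq_or_lt with e | e
    · exact ⟨_, _, _, .north h₂ i₂ i₃ j₂ H₂ c₂ e₂, e.symm⟩
    · exact ih (by omega)
  | east h₂ i₂ j₂ j₃ H₂ c₂ e₂ ih =>
    rcases h₁.eq_or_lt with e | e
    · exact ⟨_, _, _, .east h₂ i₂ j₂ j₃ H₂ c₂ e₂, e.symm⟩
    · exact ih (by omega)

theorem Enters.start_diagonal_le (H : Enters B k h i j) : (k : ℤ) - (n - 1) ≤ (j : ℤ) - i := by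
  have := Fin.le_def.1 H.start_le
  have := i.2
  omega

/-- Pipes move weakly north and east. -/
theorem Enters.monotone (H : Enters B k h i j) (H' : Enters B k h' i' j')
    (e : (j : ℤ) - i ≤ j' - i') : i' ≤ i ∧ j ≤ j' := by
  induction H' with
  | start i₀ hi =>
    have h₁ := Fin.le_def.1 H.start_le
    have := i.2
    rw [Fin.le_def, Fin.le_def]; omega
  | north h₂ i₂ i₃ j₂ H₂ c₂ e₂ ih =>
    rcases e.eq_or_lt with e | e
    · obtain ⟨-, rfl, rfl⟩ := H.unique (.north h₂ i₂ i₃ j₂ H₂ c₂ e₂) e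
      exact ⟨le_rfl, le_rfl⟩
    · have := ih (by omega)
      rw [Fin.le_def, Fin.le_def] at *; omega
  | east h₂ i₂ j₂ j₃ H₂ c₂ e₂ ih =>
    rcases e.eq_or_lt with e | e
    · obtain ⟨-, rfl, rfl⟩ := H.unique (.east h₂ i₂ j₂ j₃ H₂ c₂ e₂) e
      exact ⟨le_rfl, le_rfl⟩
    · have := ih (by omega)
      rw [Fin.le_def, Fin.le_def] at *; omega

/-- Only one pipe passes through each edge. -/
theorem Enters.label_unique (H : Enters B k h i j) : Enters B l h i j → k = l := by
  induction H with
  | start i hi =>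
    intro H'
    cases H' with
    | start => rfl
    | north _ i₀ => have := i₀.2; omega
  | north h₁ i₁ i₂ j₁ H₁ c₁ e₁ ih =>
    intro H'
    cases H' with
    | start => have := i₁.2; omega
    | north _ i₀ _ _ H₀ c₀ e₀ =>
      obtain rfl : i₁ = i₀ := Fin.ext (by omega)
      obtain rfl := c₁.entry_unique c₀
      exact ih H₀
  | east h₁ i₁ j₁ j₂ H₁ c₁ e₁ ih =>
    intro H'
    cases H' with
    | east _ _ j₀ _ H₀ c₀ e₀ =>
      obtain rfl : j₁ = j₀ := Fin.ext (by omega)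
      obtain rfl := c₁.entry_unique c₀
      exact ih H₀

theorem Enters.hasEntry (hB : IsJoined B) (H : Enters B k h i j) : (B i j).HasEntry h := by
  cases H with
  | start _ hi => exact hB.bottomEdge _ _ hi
  | north h₁ i₁ _ _ H₁ c₁ e₁ => exact (hB.joinVertical _ _ _ e₁.symm).2 ⟨_, c₁⟩
  | east h₁ _ j₁ _ H₁ c₁ e₁ => exact (hB.joinHorizontal _ _ _ e₁).1 ⟨_, c₁⟩

/-- Follow the strand backwards: each step goes south or west, it cannot leave through the left
edge, so it reaches the bottom edge. -/
theorem IsJoined.exists_enters (hB : IsJoined B) (hh : (B i j).HasEntry h) :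
    ∃ k, Enters B k h i j := by
  obtain ⟨m, hm⟩ : ∃ m : ℕ, j.val + (n - i.val) = m := ⟨_, rfl⟩
  induction m generalizing h i j with
  | zero => have := i.2; omega
  | succ m ih =>
    cases h with
    | north =>
      by_cases hi : i.val + 1 = n
      · exact ⟨j, .start i hi⟩
      · have hi' : i.val + 1 < n := by have := i.2; omega
        obtain ⟨h', c⟩ := (hB.joinVertical i ⟨i.val + 1, hi'⟩ j rfl).1 hh
        obtain ⟨k, H⟩ := ih ⟨_, c⟩ (by simp only; omega)
        exact ⟨k, .north _ _ _ _ H c rfl⟩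
    | east =>
      by_cases hj : j.val = 0
      · exact absurd hh (hB.leftEdge _ _ hj)
      · have hj' : j.val - 1 < n := by have := j.2; omega
        have e : j.val = (⟨j.val - 1, hj'⟩ : Fin n).val + 1 := by simp only; omega
        obtain ⟨h', c⟩ := (hB.joinHorizontal i ⟨j.val - 1, hj'⟩ j e).2 hh
        obtain ⟨k, H⟩ := ih ⟨_, c⟩ (by have := i.2; simp only; omega)
        exact ⟨k, .east _ _ _ _ H c e⟩

/-- A pipe stays weakly below the row in which it terminates. -/
theorem Enters.diagonal_le (H : Enters B k h i j) {x : Fin n} (hx : Terminates B k x) :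
    (j : ℤ) - i ≤ (n - 1) - x := by
  obtain ⟨h₁, m, hm, H₁, c₁⟩ := hx
  by_contra hlt
  -- On the diagonal of its last cell the pipe leaves the grid eastwards, so no further step is
  -- possible.
  have key : ∀ {h : Heading} {i j : Fin n}, Enters B k h i j → (j : ℤ) - i ≤ (n - 1) - x := by
    intro h i j H
    induction H with
    | start i hi =>
      have := Fin.le_def.1 H₁.start_le
      have := x.2
      omega
    | north h₂ i₂ i₃ j₂ H₂ c₂ e₂ ih =>
      rcases ih.eq_or_lt with e | e
      · obtain ⟨rfl, rfl, rfl⟩ := H₁.unique H₂ (by omega)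
        exact absurd (c₁.exit_unique c₂) (by simp)
      · omega
    | east h₂ i₂ j₂ j₃ H₂ c₂ e₂ ih =>
      rcases ih.eq_or_lt with e | e
      · obtain ⟨rfl, rfl, rfl⟩ := H₁.unique H₂ (by omega)
        have := j₃.2
        omega
      · omega
  exact hlt (key H)

theorem Enters.terminates_le (H : Enters B k h i j) {x : Fin n} (hx : Terminates B k x) :
    x ≤ i := by
  have e := H.diagonal_le hx
  obtain ⟨h₁, m, hm, H₁, c₁⟩ := hx
  exact (H.monotone H₁ (by omega)).1

theorem Terminates.row_unique {x y : Fin n} (hx : Terminates B k x) (hy : Terminates B k y) :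
    x = y := by
  have h₁ := hx
  have h₂ := hy
  obtain ⟨_, _, _, H₁, _⟩ := h₁
  obtain ⟨_, _, _, H₂, _⟩ := h₂
  exact le_antisymm (H₂.terminates_le hx) (H₁.terminates_le hy)

theorem Terminates.label_unique {x : Fin n} (hk : Terminates B k x) (hl : Terminates B l x) :
    k = l := by
  obtain ⟨h₁, j₁, e₁, H₁, c₁⟩ := hk
  obtain ⟨h₂, j₂, e₂, H₂, c₂⟩ := hl
  obtain rfl : j₁ = j₂ := Fin.ext (by omega)
  obtain rfl := c₁.entry_unique c₂
  exact H₁.label_unique H₂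

theorem Tile.HasEntry.carries_east {t : Tile} (h : t.HasEntry .east) (h' : t ≠ .upElbow) :
    t.Carries .east .east := by
  rcases Tile.hasEntry_east.1 h with rfl | rfl | rfl
  exacts [absurd rfl h', .crossEast, .horizontal]

/-- A pipe that leaves a cell eastwards, with no turn to the north on its right, terminates in
the row of that cell. -/
theorem Enters.terminates_of_carries (hB : IsJoined B) (H : Enters B k h i j)
    (c : (B i j).Carries h .east) (hr : ∀ y, j < y → B i y ≠ .upElbow) :
    Terminates B k i := by
  obtain ⟨m, hm⟩ : ∃ m : ℕ, n - j.val = m := ⟨_, rfl⟩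
  induction m generalizing h j with
  | zero => have := j.2; omega
  | succ m ih =>
    by_cases hj : j.val + 1 = n
    · exact ⟨h, j, hj, H, c⟩
    · have hj' : j.val + 1 < n := by have := j.2; omega
      have H' : Enters B k .east i ⟨j.val + 1, hj'⟩ := .east _ _ _ _ H c rfl
      refine ih H' ((H'.hasEntry hB).carries_east (hr _ ?_)) (fun y hy => hr y ?_) ?_
      · rw [Fin.lt_def]; simp
      · rw [Fin.lt_def] at *; simp only at hy; omega
      · simp only; omega

end Paths

/-! ### Regions forced to look like the Rothe pipe dream -/

section Region

variable {n : ℕ} {B : Tiling n} {w : Equiv.Perm (Fin n)} {k l : Fin n} {h : Heading}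
  {i j a b : Fin n}

/-- A tile that is neither blank nor turns a pipe to the north. -/
def Tile.IsStraight (t : Tile) : Prop := t ≠ .blank ∧ t ≠ .upElbow

/-- Only an up-elbow turns a pipe from east to north, so without one below the pipe has come
straight up its column. -/
theorem Enters.eq_of_north (hr : ∀ x, i < x → B x j ≠ .upElbow) (H : Enters B k .north i j) :
    k = j := by
  obtain ⟨m, hm⟩ : ∃ m : ℕ, n - i.val = m := ⟨_, rfl⟩
  induction m generalizing i with
  | zero => have := i.2; omega
  | succ m ih =>
    cases H with
    | start => rfl
    | north h₁ i₁ _ _ H₁ c₁ e₁ =>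
      have hi : i < i₁ := by rw [Fin.lt_def]; omega
      have hne := hr i₁ hi
      have : h₁ = .north := by
        generalize B i₁ j = t at *
        cases c₁ <;> simp_all
      subst this
      exact ih (fun x hx => hr x (hi.trans hx)) H₁ (by omega)

/-- The pipe starting in column `j` climbs to row `i` if it meets no up-elbow, unless it
terminates below. -/
theorem IsJoined.climb (hB : IsJoined B)
    (hr : ∀ x y, i < x → j ≤ y → B x y ≠ .upElbow) :
    Enters B j .north i j ∨ ∃ x, i < x ∧ Terminates B j x := by
  obtain ⟨m, hm⟩ : ∃ m : ℕ, n - i.val = m := ⟨_, rfl⟩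
  induction m generalizing i with
  | zero => have := i.2; omega
  | succ m ih =>
    by_cases hi : i.val + 1 = n
    · exact .inl (.start i hi)
    have hi' : i.val + 1 < n := by have := i.2; omega
    set i₁ : Fin n := ⟨i.val + 1, hi'⟩
    have hlt : i < i₁ := by rw [Fin.lt_def]; simp [i₁]
    rcases ih (i := i₁) (fun x y hx => hr x y (hlt.trans hx)) (by simp only [i₁]; omega) with
      H | ⟨x, hx, hT⟩
    · obtain ⟨g, c⟩ := H.hasEntry hB
      cases g with
      | north => exact .inl (.north _ _ _ _ H c rfl)
      | east =>
        exact .inr ⟨i₁, hlt, H.terminates_of_carries hB c fun y hy => hr _ _ hlt hy.le⟩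
    · exact .inr ⟨x, hlt.trans hx, hT⟩

theorem terminates_iff (hw : ∀ x, Terminates B (w x) x) {x : Fin n} :
    Terminates B k x ↔ w x = k :=
  ⟨fun H => (hw x).label_unique H, fun e => e ▸ hw x⟩

theorem terminates_symm (hw : ∀ x, Terminates B (w x) x) (k : Fin n) :
    Terminates B k (w⁻¹ k) := by
  simpa using hw (w⁻¹ k)

theorem Enters.inv_le (hw : ∀ x, Terminates B (w x) x) (H : Enters B k h i j) : w⁻¹ k ≤ i :=
  H.terminates_le (terminates_symm hw k)

/-- Traced backwards along the row, the pipe cannot pass the right side of `(i, j)`. It must have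
come into the row from below, in a column right of `j`, and it has climbed that column from its
start. -/
theorem Enters.lt_of_row (hcol : ∀ x y, i ≤ x → j < y → B x y ≠ .upElbow)
    (hj : ¬ (B i j).HasExit .east) {y : Fin n} (hy : j ≤ y) (H : Enters B k h i y)
    (c : (B i y).Carries h .east) : j < k := by
  obtain ⟨m, hm⟩ : ∃ m : ℕ, y.val = m := ⟨_, rfl⟩
  induction m generalizing h y with
  | zero =>
    obtain rfl : j = y := le_antisymm hy (by rw [Fin.le_def]; omega)
    exact absurd ⟨_, c⟩ hj
  | succ m ih =>
    rcases hy.eq_or_lt with rfl | hlt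
    · exact absurd ⟨_, c⟩ hj
    cases h with
    | north =>
      rw [H.eq_of_north fun x hx => hcol x y hx.le hlt]
      exact hlt
    | east =>
      cases H with
      | east h₁ _ y₁ _ H₁ c₁ e₁ =>
        refine ih ?_ H₁ c₁ (by omega)
        rw [Fin.lt_def] at hlt; rw [Fin.le_def]; omega

/-- Without up-elbows the pipe of column `j` climbs straight until it turns east, and then it
terminates in that row. Hence it reaches row `i` exactly when its final row is not below `i`. -/
theorem IsJoined.hasEntry_north_iff (hB : IsJoined B) (hw : ∀ x, Terminates B (w x) x)
    (hr : ∀ x y, i ≤ x → j ≤ y → i < x ∨ j < y → B x y ≠ .upElbow) :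
    (B i j).HasEntry .north ↔ w⁻¹ j ≤ i := by
  constructor
  · intro H
    obtain ⟨k, H⟩ := hB.exists_enters H
    have := H.eq_of_north fun x hx => hr x j hx.le le_rfl (.inl hx)
    subst this
    exact H.inv_le hw
  · intro H
    rcases hB.climb fun x y hx hy => hr x y hx.le hy (.inl hx) with H' | ⟨x, hx, hT⟩
    · exact H'.hasEntry hB
    · rw [hT.row_unique (terminates_symm hw j)] at hx
      exact absurd H (not_le.2 hx)

theorem IsJoined.hasExit_east_iff (hB : IsJoined B) (hw : ∀ x, Terminates B (w x) x)
    (hr : ∀ x y, i ≤ x → j ≤ y → i < x ∨ j < y → B x y ≠ .upElbow) :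
    (B i j).HasExit .east ↔ w i ≤ j := by
  constructor
  · rintro ⟨h, c⟩
    obtain ⟨k, H⟩ := hB.exists_enters ⟨_, c⟩
    have := H.terminates_of_carries hB c fun y hy => hr i y le_rfl hy.le (.inr hy)
    rw [(terminates_iff hw).1 this]
    exact H.start_le
  · intro H
    by_contra hj
    obtain ⟨h, y, hy, H', c⟩ := hw i
    refine absurd (H'.lt_of_row (fun x y hx hy => hr x y hx hy.le (.inr hy)) hj ?_ c)
      (not_lt.2 H)
    rw [Fin.le_def]; have := j.2; omega

/-- If all cells weakly southeast of `(i, j)` are straight, a tile at `(i, j)` that is not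
straight lies in the Rothe diagram. -/
theorem IsJoined.mem_rotheDiagram (hB : IsJoined B) (hw : ∀ x, Terminates B (w x) x)
    (hr : ∀ x y, i ≤ x → j ≤ y → i < x ∨ j < y → B x y ≠ .upElbow)
    (hij : ¬ (B i j).IsStraight) : (i, j) ∈ rotheDiagram w := by
  have hN := hB.hasEntry_north_iff hw hr
  have hE := hB.hasExit_east_iff hw hr
  rw [Tile.hasEntry_north] at hN
  rw [Tile.hasExit_east] at hE
  have hc : B i j = .blank ∨ B i j = .upElbow := by
    unfold Tile.IsStraight at hij; tauto
  have h₁ : ¬ w⁻¹ j ≤ i := by rw [← hN]; rcases hc with e | e <;> simp [e]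
  have h₂ : ¬ w i ≤ j := by rw [← hE]; rcases hc with e | e <;> simp [e]
  exact ⟨not_le.1 h₂, not_le.1 h₁⟩

/-- The tile of the Rothe pipe dream of `w`, whose pipes are hooks. -/
def rotheTile (w : Equiv.Perm (Fin n)) (i j : Fin n) : Tile :=
  if w i = j then .downElbow
  else if j < w i then (if w⁻¹ j ≤ i then .vertical else .blank)
  else (if w⁻¹ j ≤ i then .cross else .horizontal)

theorem inv_apply_ne (e : w i ≠ j) : w⁻¹ j ≠ i := fun h => e (by rw [← h]; simp)

theorem rotheTile_hasEntry_north : (rotheTile w i j).HasEntry .north ↔ w⁻¹ j ≤ i := by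
  rw [Tile.hasEntry_north]; unfold rotheTile
  split_ifs with h₁ <;> simp_all
  rw [← h₁]; simp

theorem rotheTile_hasExit_east : (rotheTile w i j).HasExit .east ↔ w i ≤ j := by
  rw [Tile.hasExit_east]; unfold rotheTile
  split_ifs <;> simp_all

theorem rotheTile_hasExit_north : (rotheTile w i j).HasExit .north ↔ w⁻¹ j < i := by
  rw [Tile.hasExit_north]; unfold rotheTile
  split_ifs with h₁ h₂ h₃ h₃
  · simp [← h₁]
  all_goals have := inv_apply_ne h₁; simp_all; omega

theorem rotheTile_hasEntry_east : (rotheTile w i j).HasEntry .east ↔ w i < j := by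
  rw [Tile.hasEntry_east]; unfold rotheTile
  split_ifs with h₁ h₂ h₃ h₃ <;> simp_all <;> omega

theorem rotheTile_ne_upElbow : rotheTile w i j ≠ .upElbow := by
  unfold rotheTile; split_ifs <;> simp

/-- A straight tile with straight tiles southeast of it is the one of the Rothe pipe dream. -/
theorem IsJoined.eq_rotheTile (hB : IsJoined B) (hw : ∀ x, Terminates B (w x) x)
    (hr : ∀ x y, i ≤ x → j ≤ y → i < x ∨ j < y → B x y ≠ .upElbow)
    (hij : (B i j).IsStraight) : B i j = rotheTile w i j := by
  have hN := hB.hasEntry_north_iff hw hr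
  have hE := hB.hasExit_east_iff hw hr
  have hcol : ∀ k, Enters B k .north i j → k = j := fun k H =>
    H.eq_of_north fun x hx => hr x j hx.le le_rfl (.inl hx)
  have hdown : B i j = .downElbow → w i = j := by
    intro e
    obtain ⟨k, H⟩ := hB.exists_enters (i := i) (j := j) (h := .north)
      (by rw [e]; exact ⟨_, .downElbow⟩)
    have := hcol k H
    subst this
    refine (terminates_iff hw).1 (H.terminates_of_carries hB ?_ ?_)
    · rw [e]; exact .downElbow
    · exact fun y hy => hr i y le_rfl hy.le (.inr hy)
  have hcross : B i j = .cross → w i ≠ j := by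
    intro e e'
    obtain ⟨k, H⟩ := hB.exists_enters (i := i) (j := j) (h := .north)
      (by rw [e]; exact ⟨_, .crossNorth⟩)
    have := hcol k H
    subst this
    -- A crossing would carry pipe `k` above the row in which it terminates.
    have hi : i.val ≠ 0 := fun hi => hB.topEdge i k hi (by rw [e]; exact ⟨_, .crossNorth⟩)
    have H' : Enters B k .north ⟨i.val - 1, by omega⟩ k :=
      .north _ _ _ _ H (by rw [e]; exact .crossNorth) (by simp only; omega)
    have := H'.inv_le hw
    rw [← e'] at this
    simp [Fin.le_def] at this
    omega
  have hinv : w i = j → w⁻¹ j = i := by rintro rfl; simp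
  obtain ⟨h₁, h₂⟩ := hij
  rw [Tile.hasEntry_north] at hN
  rw [Tile.hasExit_east] at hE
  unfold rotheTile
  generalize B i j = t at *
  cases t <;> simp at * <;> split_ifs <;> simp_all <;> omega

end Region

/-! ### Crossings and inversions -/

section Order

variable {n : ℕ} {B : Tiling n} {w : Equiv.Perm (Fin n)} {k l : Fin n} {h h' : Heading}
  {i i' j j' : Fin n}

/-- The position on its diagonal of the edge through which a pipe enters a cell in column `j`
with heading `h`, counted from the northwest. -/
def edgeKey (h : Heading) (j : Fin n) : ℕ :=
  match h with
  | .north => 2 * j.val + 1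
  | .east => 2 * j.val

theorem CrossAt.symm {i j : Fin n} (H : CrossAt B k l i j) : CrossAt B l k i j :=
  ⟨H.1, H.2.symm.imp And.symm And.symm⟩

theorem edgeKey_bounds (h : Heading) (j : Fin n) :
    2 * j.val ≤ edgeKey h j ∧ edgeKey h j ≤ 2 * j.val + 1 := by
  cases h <;> simp [edgeKey]

/-- Two pipes in one cell cross there. -/
theorem crossAt_of_edgeKey_lt (hB : IsJoined B) (Hk : Enters B k h i j) (Hl : Enters B l h' i j)
    (hlt : edgeKey h j < edgeKey h' j) :
    CrossAt B k l i j ∧ h = .east ∧ h' = .north := by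
  have hh : h = .east ∧ h' = .north := by
    cases h <;> cases h' <;> simp_all [edgeKey]
  obtain ⟨rfl, rfl⟩ := hh
  refine ⟨⟨?_, .inr ⟨Hk, Hl⟩⟩, rfl, rfl⟩
  have h₁ := Tile.hasEntry_east.1 (Hk.hasEntry hB)
  have h₂ := Tile.hasEntry_north.1 (Hl.hasEntry hB)
  rcases h₁ with e | e | e <;> simp_all

/-- Two pipes keep their order on the diagonals as long as they do not cross. -/
theorem Enters.edgeKey_lt (hB : IsJoined B)
    {h₀ h₀' : Heading} {i₀ j₀ i₀' j₀' : Fin n} (Hk₀ : Enters B k h₀ i₀ j₀)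
    (Hl₀ : Enters B l h₀' i₀' j₀') (e₀ : (j₀ : ℤ) - i₀ = j₀' - i₀')
    (hlt : edgeKey h₀ j₀ < edgeKey h₀' j₀') (Hl : Enters B l h' i' j') :
    ∀ {h : Heading} {i j : Fin n}, Enters B k h i j → (j : ℤ) - i = j' - i' →
      (j₀ : ℤ) - i₀ ≤ j - i →
      (∀ x y, CrossAt B k l x y → (j₀ : ℤ) - i₀ ≤ y - x → (y : ℤ) - x < j - i → False) →
      edgeKey h j < edgeKey h' j' := by
  have hbase : ∀ {h h' : Heading} {i j i' j' : Fin n}, Enters B l h' i' j' →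
      Enters B k h i j → (j : ℤ) - i = j' - i' → (j₀ : ℤ) - i₀ = j - i →
      edgeKey h j < edgeKey h' j' := by
    intro h h' i j i' j' Hl Hk e e'
    obtain ⟨rfl, rfl, rfl⟩ := Hk₀.unique Hk e'
    obtain ⟨rfl, rfl, rfl⟩ := Hl₀.unique Hl (by omega)
    exact hlt
  have hstep : ∀ {h h' g g' : Heading} {i j i' j' : Fin n} (m m' : Fin n),
      Enters B l h' i' j' → Enters B k h i j → (j : ℤ) - i = j' - i' →
      (B i j).Carries h g → (B i' j').Carries h' g' →
      edgeKey h j < edgeKey h' j' → ¬ CrossAt B k l i j →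
      (g = .north ∧ m = j ∨ g = .east ∧ m.val = j.val + 1) →
      (g' = .north ∧ m' = j' ∨ g' = .east ∧ m'.val = j'.val + 1) →
      edgeKey g m < edgeKey g' m' := by
    intro h h' g g' i j i' j' m m' Hl Hk e c c' hlt hX hm hm'
    have hb := edgeKey_bounds h j
    have hb' := edgeKey_bounds h' j'
    have hne : j.val ≠ j'.val := by
      intro ej
      obtain rfl : j = j' := Fin.ext ej
      obtain rfl : i = i' := Fin.ext (by omega)
      exact hX (crossAt_of_edgeKey_lt hB Hk Hl hlt).1
    rcases hm with ⟨rfl, rfl⟩ | ⟨rfl, hm⟩ <;> rcases hm' with ⟨rfl, rfl⟩ | ⟨rfl, hm'⟩ <;>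
      simp only [edgeKey] <;> omega
  induction Hl with
  | start i₁ hi =>
    intro h i j Hk e e' _
    refine hbase (.start i₁ hi) Hk e (le_antisymm e' ?_)
    have := Hl₀.start_diagonal_le
    omega
  | north h₁ i₁ i₂ j₁ H₁ c₁ e₁ ih =>
    intro h i j Hk e e' hX
    rcases e'.eq_or_lt with e' | e'
    · exact hbase (.north h₁ i₁ i₂ j₁ H₁ c₁ e₁) Hk e e'
    cases Hk with
    | start _ hi =>
      have := Hk₀.start_diagonal_le
      omega
    | north h₂ i₂ _ _ H₂ c₂ e₂ =>
      have := ih H₂ (by omega) (by omega) fun x y H a b => hX x y H a (by omega)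
      exact hstep _ _ H₁ H₂ (by omega) c₂ c₁ this
        (fun H => hX _ _ H (by omega) (by omega)) (.inl ⟨rfl, rfl⟩) (.inl ⟨rfl, rfl⟩)
    | east h₂ _ j₂ _ H₂ c₂ e₂ =>
      have := ih H₂ (by omega) (by omega) fun x y H a b => hX x y H a (by omega)
      exact hstep _ _ H₁ H₂ (by omega) c₂ c₁ this
        (fun H => hX _ _ H (by omega) (by omega)) (.inr ⟨rfl, e₂⟩) (.inl ⟨rfl, rfl⟩)
  | east h₁ i₁ j₁ j₂ H₁ c₁ e₁ ih =>
    intro h i j Hk e e' hX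
    rcases e'.eq_or_lt with e' | e'
    · exact hbase (.east h₁ i₁ j₁ j₂ H₁ c₁ e₁) Hk e e'
    cases Hk with
    | start _ hi =>
      have := Hk₀.start_diagonal_le
      omega
    | north h₂ i₂ _ _ H₂ c₂ e₂ =>
      have := ih H₂ (by omega) (by omega) fun x y H a b => hX x y H a (by omega)
      exact hstep _ _ H₁ H₂ (by omega) c₂ c₁ this
        (fun H => hX _ _ H (by omega) (by omega)) (.inl ⟨rfl, rfl⟩) (.inr ⟨rfl, e₁⟩)
    | east h₂ _ j₂ _ H₂ c₂ e₂ =>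
      have := ih H₂ (by omega) (by omega) fun x y H a b => hX x y H a (by omega)
      exact hstep _ _ H₁ H₂ (by omega) c₂ c₁ this
        (fun H => hX _ _ H (by omega) (by omega)) (.inr ⟨rfl, e₂⟩) (.inr ⟨rfl, e₁⟩)

/-- Before their first crossing, the pipe that starts further left is northwest of the other. -/
theorem Enters.edgeKey_lt_of_lt (hB : IsJoined B) (hkl : k < l) (Hk : Enters B k h i j)
    (Hl : Enters B l h' i' j') (e : (j : ℤ) - i = j' - i')
    (hX : ∀ x y, CrossAt B k l x y → (y : ℤ) - x < j - i → False) :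
    edgeKey h j < edgeKey h' j' := by
  have hn : 0 < n := k.pos
  have hkl' := Fin.lt_def.1 hkl
  have hd := Hl.start_diagonal_le
  obtain ⟨h₁, i₁, j₁, H₁, e₁⟩ := Hk.exists_on_diagonal ((l : ℤ) - (n - 1)) (by omega) (by omega)
  have Hs : Enters B l .north ⟨n - 1, by omega⟩ l := .start _ (by simp only; omega)
  have hi₁ := i₁.2
  -- On the diagonal where pipe `l` starts, its bottom edge is the southeasternmost one.
  refine H₁.edgeKey_lt hB Hs (by simp only; omega) ?_ Hl Hk e (by omega)
    fun x y H _ b => hX x y H b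
  cases h₁ with
  | east => simp only [edgeKey]; omega
  | north =>
    have : j₁ ≠ l := by
      rintro rfl
      have hi : i₁ = ⟨n - 1, by omega⟩ := Fin.ext (by simp only; omega)
      exact hkl.ne (H₁.label_unique (hi ▸ Hs))
    have : j₁.val ≠ l.val := fun h => this (Fin.ext h)
    simp only [edgeKey]; omega

/-- Pipes that cross exactly once are in inverted order at the right edge. -/
theorem CrossAt.inv_lt (hB : IsBPD B) (hw : ∀ x, Terminates B (w x) x) (hkl : k < l)
    (H : CrossAt B k l i j) : w⁻¹ l < w⁻¹ k := by
  have hJ := hB.isJoined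
  have huniq : ∀ x y, CrossAt B k l x y → x = i ∧ y = j := fun x y H' =>
    hB.crossOnce k l hkl.ne x y i j H' H
  have hb : B i j = .cross := H.1
  have Hkl : Enters B k .east i j ∧ Enters B l .north i j := by
    rcases H.2 with ⟨H₁, H₂⟩ | H'
    · have := H₁.edgeKey_lt_of_lt hJ hkl H₂ rfl fun x y hX hlt => by
        obtain ⟨rfl, rfl⟩ := huniq x y hX
        exact lt_irrefl _ hlt
      simp [edgeKey] at this
    · exact H'
  obtain ⟨Hk, Hl⟩ := Hkl
  by_contra hle
  have hTk := terminates_symm hw k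
  have hTl := terminates_symm hw l
  have hne : w⁻¹ k ≠ w⁻¹ l := fun e => hkl.ne (w⁻¹.injective e)
  have hlt : w⁻¹ k < w⁻¹ l := lt_of_le_of_ne (not_lt.1 hle) hne
  have hd := Hl.diagonal_le hTl
  have hlt' := Fin.lt_def.1 hlt
  obtain ⟨hl, jl, el, Hl', cl⟩ := hTl
  obtain ⟨hk, jk, ek, Hk', ck⟩ := hTk
  generalize w⁻¹ l = y at *
  generalize w⁻¹ k = x at *
  have hstart := Hk.start_diagonal_le
  -- Pipe `l` ends in the lower row `y`, so pipe `k` is still in the grid on the diagonal of the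
  -- last cell of `l`.
  obtain ⟨h₁, i₁, j₁, H₁, e₁⟩ := Hk'.exists_on_diagonal ((jl : ℤ) - y) (by omega) (by omega)
  rcases (show (j : ℤ) - i ≤ jl - y by omega).eq_or_lt with e | e
  · obtain ⟨rfl, rfl, rfl⟩ := Hl.unique Hl' e
    rw [hb] at cl
    cases cl
  · -- compare the pipes one step after the crossing
    obtain ⟨h₃, i₃, j₃, H₃, e₃⟩ := H₁.exists_on_diagonal ((j : ℤ) - i + 1)
      (by omega) (by omega)
    have hi0 : i.val ≠ 0 := fun hi => hJ.topEdge i j hi (by rw [hb]; exact ⟨_, .crossNorth⟩)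
    have Hl₂ : Enters B l .north ⟨i.val - 1, by omega⟩ j :=
      .north _ _ _ _ Hl (by rw [hb]; exact .crossNorth) (by simp only; omega)
    have hk₃ : edgeKey .north j < edgeKey h₃ j₃ := by
      cases H₃ with
      | start _ hi => omega
      | north h₄ i₄ _ _ H₄ c₄ e₄ =>
        obtain ⟨rfl, rfl, rfl⟩ := Hk.unique H₄ (by omega)
        rw [hb] at c₄
        cases c₄
      | east h₄ _ j₄ _ H₄ c₄ e₄ =>
        obtain ⟨rfl, rfl, rfl⟩ := Hk.unique H₄ (by omega)
        simp only [edgeKey]; omega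
    have hfin := Hl₂.edgeKey_lt hJ H₃ (by simp only; omega) hk₃ H₁ Hl' (by omega)
      (by simp only; omega) fun x y hX h₁ h₂ => by
        obtain ⟨rfl, rfl⟩ := huniq x y hX.symm
        simp only at h₁
        omega
    -- After the crossing `l` stays northwest of `k`. Since `l` is now in the last column, `k` has
    -- to share its cell, which would be a second crossing.
    have hb₁ := edgeKey_bounds h₁ j₁
    have hb₂ := edgeKey_bounds hl jl
    have hj₁ := j₁.2
    obtain rfl : jl = j₁ := Fin.ext (by omega)
    obtain rfl : y = i₁ := Fin.ext (by omega)
    have hX := (crossAt_of_edgeKey_lt hJ Hl' H₁ hfin).1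
    obtain ⟨rfl, rfl⟩ := huniq _ _ hX.symm
    exact lt_irrefl _ e

end Order

/-! ### Length of a permutation times a transposition -/

section Length

variable {n : ℕ}

/-- The indicator of an inversion. -/
def inversionIndicator (w : Equiv.Perm (Fin n)) (p q : Fin n) : ℕ :=
  if p < q ∧ w q < w p then 1 else 0

theorem coxeterLength_eq_sum (w : Equiv.Perm (Fin n)) :
    coxeterLength w = ∑ p, ∑ q, inversionIndicator w p q := by
  unfold coxeterLength inversionIndicator
  rw [Finset.card_filter, ← Finset.univ_product_univ, Finset.sum_product]

theorem sum_univ_eq_two_add {i a : Fin n} (hia : i ≠ a) (f : Fin n → ℕ) :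
    ∑ p, f p = f i + f a + ∑ p ∈ (Finset.univ.erase i).erase a, f p := by
  rw [← Finset.add_sum_erase _ _ (Finset.mem_univ i),
    ← Finset.add_sum_erase (Finset.univ.erase i) _ (by simp [hia.symm] : a ∈ _), add_assoc]

/-- Only pairs that meet `{i, a}` change. The pair itself gains one inversion; the two pairs of
another row `m` with `i` and `a` gain two in total if `m` lies between in position and in value, and
none otherwise. -/
theorem coxeterLength_mul_swap {v : Equiv.Perm (Fin n)} {i a : Fin n} (hia : i < a)
    (hv : v i < v a) :
    coxeterLength (v * Equiv.swap i a) = coxeterLength v + 1 +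
      2 * (Finset.univ.filter fun m => i < m ∧ m < a ∧ v i < v m ∧ v m < v a).card := by
  set S := (Finset.univ.erase i).erase a with hS
  have hsplit : ∀ u : Equiv.Perm (Fin n), coxeterLength u =
      inversionIndicator u i i + inversionIndicator u i a + inversionIndicator u a i +
        inversionIndicator u a a +
      ∑ m ∈ S, (inversionIndicator u i m + inversionIndicator u a m +
        inversionIndicator u m i + inversionIndicator u m a) +
      ∑ m ∈ S, ∑ m' ∈ S, inversionIndicator u m m' := by
    intro u
    rw [coxeterLength_eq_sum, sum_univ_eq_two_add hia.ne]
    simp_rw [sum_univ_eq_two_add hia.ne (inversionIndicator u _), Finset.sum_add_distrib]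
    rw [← hS]
    ring
  have hcard : (Finset.univ.filter fun m => i < m ∧ m < a ∧ v i < v m ∧ v m < v a).card =
      ∑ m ∈ S, if i < m ∧ m < a ∧ v i < v m ∧ v m < v a then 1 else 0 := by
    rw [Finset.card_filter, sum_univ_eq_two_add hia.ne, ← hS]
    simp only [lt_irrefl, false_and, and_false, if_false, zero_add]
  have hswap : ∀ m ∈ S, (v * Equiv.swap i a) m = v m := by
    intro m hm
    simp only [hS, Finset.mem_erase] at hm
    simp [Equiv.swap_apply_of_ne_of_ne hm.2.1 hm.1]
  have hi : (v * Equiv.swap i a) i = v a := by simp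
  have ha : (v * Equiv.swap i a) a = v i := by simp
  rw [hsplit, hsplit v, hcard]
  have h₁ : ∑ m ∈ S, ∑ m' ∈ S, inversionIndicator (v * Equiv.swap i a) m m' =
      ∑ m ∈ S, ∑ m' ∈ S, inversionIndicator v m m' := by
    refine Finset.sum_congr rfl fun m hm => Finset.sum_congr rfl fun m' hm' => ?_
    unfold inversionIndicator
    rw [hswap m hm, hswap m' hm']
  have h₂ : ∑ m ∈ S, (inversionIndicator (v * Equiv.swap i a) i m +
        inversionIndicator (v * Equiv.swap i a) a m +
        inversionIndicator (v * Equiv.swap i a) m i +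
        inversionIndicator (v * Equiv.swap i a) m a) =
      ∑ m ∈ S, (inversionIndicator v i m + inversionIndicator v a m +
        inversionIndicator v m i + inversionIndicator v m a) +
      2 * ∑ m ∈ S, if i < m ∧ m < a ∧ v i < v m ∧ v m < v a then 1 else 0 := by
    rw [Finset.mul_sum, ← Finset.sum_add_distrib]
    refine Finset.sum_congr rfl fun m hm => ?_
    have hm' := hm
    simp only [hS, Finset.mem_erase] at hm'
    have n₁ : v m ≠ v i := fun e => hm'.2.1 (v.injective e)
    have n₂ : v m ≠ v a := fun e => hm'.1 (v.injective e)
    unfold inversionIndicator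
    rw [hi, ha, hswap m hm]
    generalize v m = y at *
    generalize v i = p at *
    generalize v a = q at *
    obtain ⟨n₃, n₄, -⟩ := hm'
    clear hsplit hcard hswap h₁ hi ha hm hS
    clear_value S
    grind (splits := 30)
  have h₃ : inversionIndicator (v * Equiv.swap i a) i i = 0 ∧
      inversionIndicator (v * Equiv.swap i a) i a = 1 ∧
      inversionIndicator (v * Equiv.swap i a) a i = 0 ∧
      inversionIndicator (v * Equiv.swap i a) a a = 0 ∧
      inversionIndicator v i i = 0 ∧ inversionIndicator v i a = 0 ∧
      inversionIndicator v a i = 0 ∧ inversionIndicator v a a = 0 := by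
    unfold inversionIndicator
    rw [hi, ha]
    simp [hia, hv, hv.le, not_lt.2 hia.le]
  obtain ⟨e₁, e₂, e₃, e₄, e₅, e₆, e₇, e₈⟩ := h₃
  rw [h₁, h₂, e₁, e₂, e₃, e₄, e₅, e₆, e₇, e₈]
  ring

theorem coxeterLength_mul_swap_eq_succ_iff {v : Equiv.Perm (Fin n)} {i a : Fin n} (hia : i < a) :
    coxeterLength (v * Equiv.swap i a) = coxeterLength v + 1 ↔
      v i < v a ∧ ∀ m, i < m → m < a → v i < v m → ¬ v m < v a := by
  rcases lt_trichotomy (v i) (v a) with hv | hv | hv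
  · rw [coxeterLength_mul_swap hia hv]
    constructor
    · intro e
      have hc : (Finset.univ.filter
          fun m => i < m ∧ m < a ∧ v i < v m ∧ v m < v a).card = 0 := by omega
      rw [Finset.card_eq_zero] at hc
      refine ⟨hv, fun m h₁ h₂ h₃ h₄ => ?_⟩
      have : m ∈ (∅ : Finset (Fin n)) := by
        rw [← hc]; simp [h₁, h₂, h₃, h₄]
      simp at this
    · rintro ⟨-, H⟩
      rw [Finset.filter_false_of_mem]
      · simp
      · rintro m - ⟨h₁, h₂, h₃, h₄⟩
        exact H m h₁ h₂ h₃ h₄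
  · exact absurd (v.injective hv) hia.ne
  · have h := coxeterLength_mul_swap (v := v * Equiv.swap i a) hia (by simpa using hv)
    have e : v * Equiv.swap i a * Equiv.swap i a = v := by
      rw [mul_assoc, Equiv.swap_mul_self, mul_one]
    rw [e] at h
    constructor
    · intro h'; omega
    · rintro ⟨h', -⟩; exact absurd h' (not_lt.2 hv.le)

end Length

/-! ### Exchanging the tiling weakly southeast of a cell -/

section Surgery

variable {n : ℕ} {B B' : Tiling n} {f g w : Equiv.Perm (Fin n)} {k l : Fin n} {h : Heading}
  {i j a b : Fin n}

/-- Weakly southeast of `(a, b)`, the tiling `B` is the Rothe pipe dream of `f`, except that at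
`(a, b)` itself only the bottom and right sides are prescribed. -/
structure IsStandard (B : Tiling n) (f : Equiv.Perm (Fin n)) (a b : Fin n) : Prop where
  tile : ∀ i j, a ≤ i → b ≤ j → a < i ∨ b < j → B i j = rotheTile f i j
  entry : (B a b).HasEntry .north ↔ f⁻¹ b ≤ a
  exit : (B a b).HasExit .east ↔ f a ≤ b

theorem eq_or_lt_of_region (ha : a ≤ i) (hb : b ≤ j) : (i = a ∧ j = b) ∨ (a < i ∨ b < j) := by
  omega

/-- If `(a, b)` is the only cell of the Rothe diagram weakly southeast of `(a, b)`, or there is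
no such cell, all pipe dreams of `w` are standard there. -/
theorem IsJoined.isStandard (hB : IsJoined B) (hw : ∀ x, Terminates B (w x) x)
    (hD : ∀ i j, a ≤ i → b ≤ j → (i, j) ∈ rotheDiagram w → i = a ∧ j = b) :
    IsStandard B w a b := by
  have hgood : ∀ i j, a ≤ i → b ≤ j → a < i ∨ b < j → (B i j).IsStraight := by
    intro i j hi hj hne
    -- Induction from the bottom right corner inwards: a first bad cell would lie in the Rothe
    -- diagram.
    obtain ⟨m, hm⟩ : ∃ m : ℕ, (n - i.val) + (n - j.val) = m := ⟨_, rfl⟩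
    induction m using Nat.strong_induction_on generalizing i j with
    | _ m ih =>
      by_contra hbad
      have hmem := hB.mem_rotheDiagram hw (i := i) (j := j) (fun x y hx hy hxy =>
        (ih ((n - x.val) + (n - y.val)) (by omega) x y (hi.trans hx) (hj.trans hy) (by omega)
          rfl).2) hbad
      have := hD i j hi hj hmem
      omega
  have hr : ∀ i j, a ≤ i → b ≤ j → ∀ x y, i ≤ x → j ≤ y → i < x ∨ j < y →
      B x y ≠ .upElbow := fun i j hi hj x y hx hy hxy =>
    (hgood x y (hi.trans hx) (hj.trans hy) (by omega)).2
  exact ⟨fun i j hi hj hne => hB.eq_rotheTile hw (hr i j hi hj) (hgood i j hi hj hne),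
    hB.hasEntry_north_iff hw (hr a b le_rfl le_rfl),
    hB.hasExit_east_iff hw (hr a b le_rfl le_rfl)⟩

namespace IsStandard

theorem hasEntry_north (S : IsStandard B f a b) (ha : a ≤ i) (hb : b ≤ j) :
    (B i j).HasEntry .north ↔ f⁻¹ j ≤ i := by
  rcases eq_or_lt_of_region ha hb with ⟨rfl, rfl⟩ | hne
  · exact S.entry
  · rw [S.tile i j ha hb hne]; exact rotheTile_hasEntry_north

theorem hasExit_east (S : IsStandard B f a b) (ha : a ≤ i) (hb : b ≤ j) :
    (B i j).HasExit .east ↔ f i ≤ j := by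
  rcases eq_or_lt_of_region ha hb with ⟨rfl, rfl⟩ | hne
  · exact S.exit
  · rw [S.tile i j ha hb hne]; exact rotheTile_hasExit_east

theorem hasExit_north (S : IsStandard B f a b) (ha : a ≤ i) (hb : b ≤ j) (hne : a < i ∨ b < j) :
    (B i j).HasExit .north ↔ f⁻¹ j < i := by
  rw [S.tile i j ha hb hne]; exact rotheTile_hasExit_north

theorem hasEntry_east (S : IsStandard B f a b) (ha : a ≤ i) (hb : b ≤ j) (hne : a < i ∨ b < j) :
    (B i j).HasEntry .east ↔ f i < j := by
  rw [S.tile i j ha hb hne]; exact rotheTile_hasEntry_east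

theorem ne_upElbow (S : IsStandard B f a b) (ha : a ≤ i) (hb : b ≤ j) (hne : a < i ∨ b < j) :
    B i j ≠ .upElbow := by
  rw [S.tile i j ha hb hne]; exact rotheTile_ne_upElbow

theorem eq_of_enters_north (S : IsStandard B f a b) (ha : a ≤ i) (hb : b ≤ j)
    (H : Enters B k .north i j) : k = j :=
  H.eq_of_north fun _ hx => S.ne_upElbow (ha.trans hx.le) hb (.inl (lt_of_le_of_lt ha hx))

theorem enters_north (S : IsStandard B f a b) (hB : IsJoined B) (ha : a ≤ i) (hb : b ≤ j)
    (hj : f⁻¹ j ≤ i) : Enters B j .north i j := by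
  obtain ⟨k, H⟩ := hB.exists_enters ((S.hasEntry_north ha hb).2 hj)
  obtain rfl := S.eq_of_enters_north ha hb H
  exact H

theorem terminates_of_east (S : IsStandard B f a b) (hB : IsJoined B) (ha : a ≤ i) (hb : b ≤ j)
    (hi : f i ≤ j) (H : Enters B k .east i j) : Terminates B k i :=
  H.terminates_of_carries hB
    (Tile.carries_east_east (H.hasEntry hB) ((S.hasExit_east ha hb).2 hi))
    fun _ hy => S.ne_upElbow ha (hb.trans hy.le) (.inr (lt_of_le_of_lt hb hy))

/-- The pipe of a row is the one that enters the standard region through that row. -/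
theorem enters_east (S : IsStandard B f a b) (hB : IsJoined B) (hf : ∀ x, Terminates B (f x) x)
    (ha : a ≤ i) (hi : f i < b) (hE : (B i b).HasEntry .east) : Enters B (f i) .east i b := by
  obtain ⟨k, H⟩ := hB.exists_enters hE
  rw [(terminates_iff hf).1 (S.terminates_of_east hB ha le_rfl hi.le H)]
  exact H

/-- A crossing in the region is between the pipe of its column and the pipe of its row. -/
theorem cross_labels (S : IsStandard B f a b) (hB : IsJoined B)
    (hf : ∀ x, Terminates B (f x) x) (ha : a ≤ i) (hb : b ≤ j) (ht : B i j = .cross)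
    (Hk : Enters B k .north i j) (Hl : Enters B l .east i j) :
    k = j ∧ l = f i ∧ l < k := by
  have hk := S.eq_of_enters_north ha hb Hk
  have hE := (S.hasExit_east ha hb).1 (by rw [ht]; exact ⟨_, .crossEast⟩)
  refine ⟨hk, ((terminates_iff hf).1 (S.terminates_of_east hB ha hb hE Hl)).symm, ?_⟩
  rw [hk]
  exact Hl.start_lt_of_east

end IsStandard

/-- `B` and `B'` agree outside the region weakly southeast of `(a, b)`, are standard in it for
`g` and `f`, and fit together at its boundary. -/
structure IsSurgery (B B' : Tiling n) (g f : Equiv.Perm (Fin n)) (a b : Fin n) : Prop where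
  agree : ∀ i j, i < a ∨ j < b → B' i j = B i j
  std : IsStandard B g a b
  std' : IsStandard B' f a b
  row : ∀ x, a < x → f x = g x ∨ (b ≤ f x ∧ b ≤ g x)
  col : ∀ y, b < y → f⁻¹ y = g⁻¹ y ∨ (a ≤ f⁻¹ y ∧ a ≤ g⁻¹ y)
  exit : (B' a b).HasExit .north ↔ (B a b).HasExit .north
  entry : (B' a b).HasEntry .east ↔ (B a b).HasEntry .east

namespace IsSurgery

theorem symm (S : IsSurgery B B' g f a b) : IsSurgery B' B f g a b where
  agree i j h := (S.agree i j h).symm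
  std := S.std'
  std' := S.std
  row x hx := (S.row x hx).imp Eq.symm And.symm
  col y hy := (S.col y hy).imp Eq.symm And.symm
  exit := S.exit.symm
  entry := S.entry.symm

/-- Right of the corner, `col` makes the final rows of the column's pipe under `f` and `g` equal or
both not above `a`, so both tilings have the same strands on the top boundary. -/
theorem hasExit_north_iff (S : IsSurgery B B' g f a b) (hj : b ≤ j) :
    (B' a j).HasExit .north ↔ (B a j).HasExit .north := by
  rcases hj.eq_or_lt with rfl | hj'
  · exact S.exit
  · rw [S.std.hasExit_north le_rfl hj (.inr hj'), S.std'.hasExit_north le_rfl hj (.inr hj')]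
    have := S.col j hj'
    omega

theorem hasEntry_east_iff (S : IsSurgery B B' g f a b) (hi : a ≤ i) :
    (B' i b).HasEntry .east ↔ (B i b).HasEntry .east := by
  rcases hi.eq_or_lt with rfl | hi'
  · exact S.entry
  · rw [S.std.hasEntry_east hi le_rfl (.inl hi'), S.std'.hasEntry_east hi le_rfl (.inl hi')]
    have := S.row i hi'
    omega

theorem isJoined (S : IsSurgery B B' g f a b) (hB : IsJoined B) : IsJoined B' where
  joinVertical i i' j e := by
    by_cases hj : j < b
    · rw [S.agree i j (.inr hj), S.agree i' j (.inr hj)]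
      exact hB.joinVertical i i' j e
    have hj := not_lt.1 hj
    by_cases hi : i < a
    · rw [S.agree i j (.inl hi), hB.joinVertical i i' j e]
      by_cases hi' : i' < a
      · rw [S.agree i' j (.inl hi')]
      · obtain rfl : i' = a := by omega
        exact (S.hasExit_north_iff hj).symm
    · have hi := not_lt.1 hi
      rw [S.std'.hasEntry_north hi hj, S.std'.hasExit_north (by omega) hj (by omega)]
      omega
  joinHorizontal i j j' e := by
    by_cases hi : i < a
    · rw [S.agree i j (.inl hi), S.agree i j' (.inl hi)]
      exact hB.joinHorizontal i j j' e
    have hi := not_lt.1 hi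
    by_cases hj : j < b
    · rw [S.agree i j (.inr hj), hB.joinHorizontal i j j' e]
      by_cases hj' : j' < b
      · rw [S.agree i j' (.inr hj')]
      · obtain rfl : j' = b := by omega
        exact (S.hasEntry_east_iff hi).symm
    · have hj := not_lt.1 hj
      rw [S.std'.hasExit_east hi hj, S.std'.hasEntry_east hi (by omega) (by omega)]
      omega
  bottomEdge i j e := by
    by_cases hj : j < b
    · rw [S.agree i j (.inr hj)]; exact hB.bottomEdge i j e
    · rw [S.std'.hasEntry_north (by omega) (not_lt.1 hj)]
      omega
  rightEdge i j e := by
    by_cases hi : i < a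
    · rw [S.agree i j (.inl hi)]; exact hB.rightEdge i j e
    · rw [S.std'.hasExit_east (not_lt.1 hi) (by omega)]
      omega
  topEdge i j e := by
    by_cases hR : i < a ∨ j < b
    · rw [S.agree i j hR]; exact hB.topEdge i j e
    · obtain rfl : i = a := by omega
      rw [S.hasExit_north_iff (by omega)]
      exact hB.topEdge i j e
  leftEdge i j e := by
    by_cases hR : i < a ∨ j < b
    · rw [S.agree i j hR]; exact hB.leftEdge i j e
    · obtain rfl : j = b := by omega
      rw [S.hasEntry_east_iff (by omega)]
      exact hB.leftEdge i j e

/-- Pipes never move west, so a pipe left of column `b` has not yet met the region. -/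
theorem enters_left (S : IsSurgery B B' g f a b) (H : Enters B k h i j) (hj : j < b) :
    Enters B' k h i j := by
  induction H with
  | start i hi => exact .start i hi
  | north h₁ i₁ i₂ j₁ H₁ c₁ e₁ ih =>
    exact .north h₁ i₁ i₂ j₁ (ih hj) (by rwa [S.agree _ _ (.inr hj)]) e₁
  | east h₁ i₁ j₁ j₂ H₁ c₁ e₁ ih =>
    have hj₁ : j₁ < b := by omega
    exact .east h₁ i₁ j₁ j₂ (ih hj₁) (by rwa [S.agree _ _ (.inr hj₁)]) e₁

theorem enters_east (S : IsSurgery B B' g f a b) (H : Enters B k .east i b) :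
    Enters B' k .east i b := by
  cases H with
  | east h₁ _ j₁ _ H₁ c₁ e₁ =>
    have hj₁ : j₁ < b := by omega
    exact .east h₁ i j₁ b (S.enters_left H₁ hj₁) (by rwa [S.agree _ _ (.inr hj₁)]) e₁

/-- Above the region the pipes of `B` and `B'` are the same up to relabelling. -/
theorem enters_top (S : IsSurgery B B' g f a b) (hB : IsJoined B)
    (hg : ∀ x, Terminates B (g x) x)
    (hleft : ∀ {k x y}, Enters B k .north x y → x.val + 1 = a.val → y < b → f (g⁻¹ k) = k)
    (hcorner : ∀ {k h x}, Enters B k h a b → (B a b).Carries h .north → x.val + 1 = a.val →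
      Enters B' (f (g⁻¹ k)) .north x b)
    (H : Enters B k h i j) (hi : i < a) : Enters B' (f (g⁻¹ k)) h i j := by
  induction H with
  | start i e => omega
  | north h₁ i₁ i₂ j₁ H₁ c₁ e₁ ih =>
    by_cases hi₁ : i₁ < a
    · exact .north h₁ i₁ i₂ j₁ (ih hi₁) (by rwa [S.agree _ _ (.inl hi₁)]) e₁
    obtain rfl : i₁ = a := by omega
    have H₂ := Enters.north h₁ i₁ i₂ j₁ H₁ c₁ e₁
    rcases lt_trichotomy j₁ b with hj | rfl | hj
    · rw [hleft H₂ e₁ hj]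
      exact .north h₁ i₁ i₂ j₁ (S.enters_left H₁ hj) (by rwa [S.agree _ _ (.inr hj)]) e₁
    · exact hcorner H₁ c₁ e₁
    -- Right of the corner, the pipe leaving the region is that of its own column. It ends above row
    -- `a`, where `col` leaves its row unchanged.
    · have hk : k = j₁ := H₂.eq_of_north fun x hx =>
        S.std.ne_upElbow (by omega) hj.le (.inr hj)
      subst hk
      have hgk := H₂.inv_le hg
      have hfk : f⁻¹ k = g⁻¹ k := (S.col k hj).resolve_right fun h => by omega
      rw [← hfk, show f (f⁻¹ k) = k by simp]
      refine .north .north i₁ i₂ k (S.std'.enters_north (S.isJoined hB) le_rfl hj.le (by omega))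
        (Tile.carries_north_north ((S.std'.hasEntry_north le_rfl hj.le).2 (by omega))
          ((S.std'.hasExit_north le_rfl hj.le (.inr hj)).2 (by omega))) e₁
  | east h₁ i₁ j₁ j₂ H₁ c₁ e₁ ih =>
    exact .east h₁ i₁ j₁ j₂ (ih hi) (by rwa [S.agree _ _ (.inl hi)]) e₁

/-- Above the region the old pipes are relabelled. In a row of the region, the pipe `f x` either
enters from the left and runs to the right edge, or starts in a column of the region and turns at
`(x, f x)`. -/
theorem terminates (S : IsSurgery B B' g f a b) (hB : IsJoined B)
    (hg : ∀ x, Terminates B (g x) x)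
    (htop : ∀ {k h i j}, Enters B k h i j → i < a → Enters B' (f (g⁻¹ k)) h i j)
    (hab : f a = b → B' a b = .downElbow)
    (hrow : f a < b → Enters B (f a) .east a b) (x : Fin n) : Terminates B' (f x) x := by
  have hB' := S.isJoined hB
  by_cases hx : x < a
  · obtain ⟨h, j, e, H, c⟩ := hg x
    have := htop H hx
    rw [show g⁻¹ (g x) = x by simp] at this
    exact ⟨h, j, e, this, by rwa [S.agree _ _ (.inl hx)]⟩
  have hx := not_lt.1 hx
  by_cases hfx : f x < b
  · refine S.std'.terminates_of_east hB' hx le_rfl hfx.le (S.enters_east ?_)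
    rcases hx.eq_or_lt with rfl | hx'
    · exact hrow hfx
    · have hfg : f x = g x := (S.row x hx').resolve_right fun h => by omega
      rw [hfg] at hfx ⊢
      exact S.std.enters_east hB hg hx hfx ((S.std.hasEntry_east hx le_rfl (.inl hx')).2 hfx)
  · have hfx := not_lt.1 hfx
    refine (S.std'.enters_north hB' hx hfx (by simp)).terminates_of_carries hB' ?_
      fun y hy => S.std'.ne_upElbow hx (by omega) (by omega)
    have ht : B' x (f x) = .downElbow := by
      rcases eq_or_lt_of_region hx hfx with ⟨rfl, e⟩ | hne
      · rw [e]; exact hab e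
      · rw [S.std'.tile x (f x) hx hfx hne]; simp [rotheTile]
    rw [ht]
    exact .downElbow

/-- A crossing in the region is between the pipes of its column and its row, which determines the
cell; neither a crossing to the left nor one above can involve this pair, by the start column of the
one and the final row of the other. Two crossings on the left, or two above, come from `B`. For one
of each, `hmix` says that the relabelling fixes both pipes, so these too come from `B`. -/
theorem isBPD (S : IsSurgery B B' g f a b) (hB : IsBPD B)
    (hf : ∀ x, Terminates B' (f x) x)
    (htop : ∀ {k h i j}, Enters B' k h i j → i < a → Enters B (g (f⁻¹ k)) h i j)
    (hmix : ∀ {k l i j i' j'}, k ≠ l → CrossAt B' k l i j → a ≤ i → j < b →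
      CrossAt B' k l i' j' → i' < a → g (f⁻¹ k) = k) : IsBPD B' := by
  have hB' := S.isJoined hB.isJoined
  refine ⟨hB'.joinVertical, hB'.joinHorizontal, hB'.bottomEdge, hB'.rightEdge, hB'.topEdge,
    hB'.leftEdge, ?_⟩
  have cross_left : ∀ {k l i j}, CrossAt B' k l i j → j < b → CrossAt B k l i j := by
    intro k l i j H hj
    exact ⟨by rw [← S.agree i j (.inr hj)]; exact H.1,
      H.2.imp (fun H => ⟨S.symm.enters_left H.1 hj, S.symm.enters_left H.2 hj⟩)
        (fun H => ⟨S.symm.enters_left H.1 hj, S.symm.enters_left H.2 hj⟩)⟩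
  have cross_top : ∀ {k l i j}, CrossAt B' k l i j → i < a →
      CrossAt B (g (f⁻¹ k)) (g (f⁻¹ l)) i j := by
    intro k l i j H hi
    exact ⟨by rw [← S.agree i j (.inl hi)]; exact H.1,
      H.2.imp (fun H => ⟨htop H.1 hi, htop H.2 hi⟩) (fun H => ⟨htop H.1 hi, htop H.2 hi⟩)⟩
  have mixed : ∀ {k l i j i' j'}, k ≠ l → CrossAt B' k l i j → CrossAt B' k l i' j' →
      a ≤ i → j < b → i' < a → i = i' ∧ j = j' := by
    intro k l i j i' j' hne H H' hi hj hi'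
    have H₂ := cross_top H' hi'
    rw [hmix hne H hi hj H' hi', hmix hne.symm H.symm hi hj H'.symm hi'] at H₂
    exact hB.crossOnce k l hne i j i' j' (cross_left H hj) H₂
  have inside : ∀ {k l i j i' j'}, Enters B' k .north i j → Enters B' l .east i j →
      B' i j = .cross → a ≤ i → b ≤ j → CrossAt B' k l i' j' → i = i' ∧ j = j' := by
    intro k l i j i' j' Hk Hl ht hi hj H'
    obtain ⟨rfl, rfl, hlt⟩ := S.std'.cross_labels hB' hf hi hj ht Hk Hl
    obtain ⟨ht', H'⟩ := H'
    have hj' : b ≤ j' := by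
      have := H'.elim (fun H => H.1.start_le) (fun H => H.1.start_le)
      omega
    have hi' : a ≤ i' := by
      have := H'.elim (fun H => H.2.terminates_le (hf i)) (fun H => H.2.terminates_le (hf i))
      omega
    rcases H' with ⟨H₁, H₂⟩ | ⟨H₁, H₂⟩
    · obtain ⟨e₁, e₂, -⟩ := S.std'.cross_labels hB' hf hi' hj' ht' H₁ H₂
      exact ⟨f.injective e₂, e₁⟩
    · obtain ⟨-, -, hlt'⟩ := S.std'.cross_labels hB' hf hi' hj' ht' H₂ H₁
      omega
  have inside' : ∀ {k l i j i' j'}, CrossAt B' k l i j → a ≤ i → b ≤ j →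
      CrossAt B' k l i' j' → i = i' ∧ j = j' := by
    intro k l i j i' j' H hi hj H'
    rcases H.2 with ⟨H₁, H₂⟩ | ⟨H₁, H₂⟩
    · exact inside H₁ H₂ H.1 hi hj H'
    · exact inside H₂ H₁ H.1 hi hj H'.symm
  intro k l hne i j i' j' H H'
  by_cases hR : a ≤ i ∧ b ≤ j
  · exact inside' H hR.1 hR.2 H'
  by_cases hR' : a ≤ i' ∧ b ≤ j'
  · have := inside' H' hR'.1 hR'.2 H
    exact ⟨this.1.symm, this.2.symm⟩
  by_cases hi : i < a <;> by_cases hi' : i' < a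
  · exact hB.crossOnce _ _ (fun e => hne (f⁻¹.injective (g.injective e))) i j i' j'
      (cross_top H hi) (cross_top H' hi')
  · have := mixed hne H' H (by omega) (by omega) hi
    exact ⟨this.1.symm, this.2.symm⟩
  · exact mixed hne H H' (by omega) (by omega) hi'
  · exact hB.crossOnce k l hne i j i' j' (cross_left H (by omega)) (cross_left H' (by omega))

end IsSurgery

end Surgery

/-! ### Surgery that changes the corner tile -/

section Corner

variable {n : ℕ} {B B' : Tiling n} {f g w v u : Equiv.Perm (Fin n)} {k l : Fin n} {h : Heading}
  {a b c i : Fin n}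

/-- Surgery at a corner that no pipe passes. -/
theorem IsSurgery.mem_BPD (S : IsSurgery B B' g f a b) (hB : B ∈ BPD g)
    (hfg : ∀ x, x < a → f x = g x) (hN : ¬ (B a b).HasExit .north)
    (hab : f a = b → B' a b = .downElbow) (hle : b ≤ f a) : B' ∈ BPD f := by
  have hinv : ∀ {k}, g⁻¹ k < a → f (g⁻¹ k) = k := fun hk => by rw [hfg _ hk]; simp
  have hinv' : ∀ {k}, f⁻¹ k < a → g (f⁻¹ k) = k := fun hk => by rw [← hfg _ hk]; simp
  have hf := S.terminates hB.1.isJoined hB.2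
    (S.enters_top hB.1.isJoined hB.2
      (fun H e _ => hinv (by have := H.inv_le hB.2; omega))
      (fun _ c _ => absurd ⟨_, c⟩ hN)) hab (fun hlt => absurd hlt (not_lt.2 hle))
  refine ⟨S.isBPD hB.1 hf
    (S.symm.enters_top (S.isJoined hB.1.isJoined) hf
      (fun H e _ => hinv' (by have := H.inv_le hf; omega))
      (fun _ c _ => absurd ⟨_, c⟩ (mt S.exit.1 hN))) ?_, hf⟩
  intro k l i j i' j' _ _ _ _ H' hi'
  refine hinv' ?_
  have := H'.2.elim (fun H => H.1.inv_le hf) (fun H => H.1.inv_le hf)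
  omega

/-- `w` has the values `w i < b < w a` in the rows `i`, `a`, `c`, in the order `w i`, `w a`, `b`;
`u` has them in the order `b`, `w i`, `w a` and agrees with `w` in all other rows. -/
structure IsCornerCycle (w u : Equiv.Perm (Fin n)) (a b c i : Fin n) : Prop where
  lt_row : i < a
  row_lt : a < c
  w_row : w c = b
  lt_w : b < w a
  w_lt : w i < b
  u_lt_row : u i = b
  u_corner : u a = w i
  u_row : u c = w a
  u_other : ∀ x, x ≠ i → x ≠ a → x ≠ c → u x = w x

namespace IsCornerCycle

theorem apply_inv_of_ne_w (C : IsCornerCycle w u a b c i)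
    (hk : w⁻¹ k < a) (hne : k ≠ w i) : u (w⁻¹ k) = k := by
  have h₁ := C.row_lt
  rw [C.u_other]
  · simp
  · intro e; apply hne; rw [← e]; simp
  · omega
  · omega

theorem apply_inv_of_ne_u (C : IsCornerCycle w u a b c i)
    (hk : u⁻¹ k < a) (hne : k ≠ b) : w (u⁻¹ k) = k := by
  have h₁ := C.row_lt
  rw [← C.u_other]
  · simp
  · intro e; apply hne; rw [← C.u_lt_row, ← e]; simp
  · omega
  · omega

theorem w_inv_u (C : IsCornerCycle w u a b c i)
    : w (u⁻¹ b) = w i := by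
  rw [show u⁻¹ b = i by rw [← C.u_lt_row]; simp]

theorem u_inv_w (C : IsCornerCycle w u a b c i)
    : u (w⁻¹ (w i)) = b := by
  rw [show w⁻¹ (w i) = i by simp, C.u_lt_row]

/-- Relabelling above the region, from `w` to `u`. -/
theorem enters_top (C : IsCornerCycle w u a b c i)
    (S : IsSurgery B B' w u a b) (hB : IsJoined B)
    (hw : ∀ x, Terminates B (w x) x) (ht : B a b = .upElbow) (ht' : B' a b = .cross)
    (hp : Enters B (w i) .east a b) {i' j' : Fin n} (H : Enters B k h i' j') (hi : i' < a) :
    Enters B' (u (w⁻¹ k)) h i' j' := by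
  refine S.enters_top hB hw ?_ ?_ H hi
  · intro k x y H e hy
    -- Pipe `w i` is still in row `a` when it reaches column `b`, so it does not leave row `a`
    -- further left.
    refine C.apply_inv_of_ne_w (by have := H.inv_le hw; omega) ?_
    rintro rfl
    have := (H.monotone hp (by omega)).1
    omega
  · intro k h x H c e
    rw [ht] at c
    cases c
    rw [H.label_unique hp, C.u_inv_w]
    have hb : u⁻¹ b = i := by rw [← C.u_lt_row]; simp
    refine .north .north a x b (S.std'.enters_north (S.isJoined hB) le_rfl le_rfl ?_) ?_ e
    · rw [hb]; exact C.lt_row.le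
    · rw [ht']; exact .crossNorth

/-- Relabelling above the region, from `u` to `w`. -/
theorem enters_top_symm (C : IsCornerCycle w u a b c i)
    (S : IsSurgery B B' w u a b) (hB' : IsJoined B')
    (hu : ∀ x, Terminates B' (u x) x) (ht : B a b = .upElbow) (ht' : B' a b = .cross)
    (hp : Enters B (w i) .east a b) {i' j' : Fin n} (H : Enters B' k h i' j') (hi : i' < a) :
    Enters B (w (u⁻¹ k)) h i' j' := by
  refine S.symm.enters_top hB' hu ?_ ?_ H hi
  · intro k x y H e hy
    refine C.apply_inv_of_ne_u (by have := H.inv_le hu; omega) ?_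
    have := H.start_le
    omega
  · intro k h x H c e
    rw [ht'] at c
    cases c
    rw [S.std'.eq_of_enters_north le_rfl le_rfl H, C.w_inv_u]
    exact .north .east a x b hp (by rw [ht]; exact .upElbow) e

theorem mem_BPD (C : IsCornerCycle w u a b c i)
    (S : IsSurgery B B' w u a b) (hB : B ∈ BPD w) (ht : B a b = .upElbow)
    (ht' : B' a b = .cross) (hp : Enters B (w i) .east a b) : B' ∈ BPD u := by
  have hu := S.terminates hB.1.isJoined hB.2
    (C.enters_top S hB.1.isJoined hB.2 ht ht' hp)
    (fun e => by have := C.w_lt; rw [C.u_corner] at e; omega)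
    (fun _ => by rw [C.u_corner]; exact hp)
  refine ⟨S.isBPD hB.1 hu
    (C.enters_top_symm S (S.isJoined hB.1.isJoined) hu ht ht' hp) ?_, hu⟩
  intro k l i j i' j' _ H _ hj H' hi'
  -- A pipe that crosses left of column `b` is not pipe `b`, the only relabelled one that ends above
  -- row `a`.
  refine C.apply_inv_of_ne_u ?_ ?_
  · have := H'.2.elim (fun H => H.1.inv_le hu) (fun H => H.1.inv_le hu)
    omega
  · have := H.2.elim (fun H => H.1.start_le) (fun H => H.1.start_le)
    omega

/-- In `B` the pipe `w i` is glued from the lower part of pipe `w i` and the upper part of pipe `b`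
of `B'`. A pipe crossing both parts is inverted with both in `u`, which puts it in the range that
`hmid` excludes. -/
theorem mem_BPD_symm (C : IsCornerCycle w u a b c i)
    (S : IsSurgery B B' w u a b) (hB' : B' ∈ BPD u) (ht : B a b = .upElbow)
    (ht' : B' a b = .cross)
    (hmid : ∀ m, i < m → m < a → w i < w m → ¬ w m < b) : B ∈ BPD w := by
  have hJ' := hB'.1.isJoined
  have hJ := S.symm.isJoined hJ'
  have hp : Enters B (w i) .east a b := by
    refine S.symm.enters_east ?_
    rw [← C.u_corner]
    exact S.std'.enters_east hJ' hB'.2 le_rfl (by rw [C.u_corner]; exact C.w_lt)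
      (by rw [ht']; exact ⟨_, .crossEast⟩)
  have hw := S.symm.terminates hJ' hB'.2
    (C.enters_top_symm S hJ' hB'.2 ht ht' hp)
    (fun e => absurd e C.lt_w.ne')
    (fun hlt => absurd hlt C.lt_w.asymm)
  refine ⟨S.symm.isBPD hB'.1 hw (C.enters_top S hJ hw ht ht' hp) ?_, hw⟩
  intro k l x y x' y' hne H hx hy H' hx'
  have hk := H'.2.elim (fun H => H.1.inv_le hw) (fun H => H.1.inv_le hw)
  have hl := H'.2.elim (fun H => H.2.inv_le hw) (fun H => H.2.inv_le hw)
  by_cases hki : k = w i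
  swap
  · exact C.apply_inv_of_ne_w (by omega) hki
  exfalso
  subst hki
  have hul := C.apply_inv_of_ne_w (k := l) (by omega) hne.symm
  have hlb : l < b := by
    have := H.2.elim (fun H => H.2.start_le) (fun H => H.2.start_le)
    omega
  have hleft : CrossAt B' (w i) l x y :=
    ⟨by rw [S.agree x y (.inr hy)]; exact H.1,
      H.2.imp (fun H => ⟨S.enters_left H.1 hy, S.enters_left H.2 hy⟩)
        (fun H => ⟨S.enters_left H.1 hy, S.enters_left H.2 hy⟩)⟩
  have hup : CrossAt B' b l x' y' := by
    have this : ∀ {k h}, Enters B k h x' y' → Enters B' (u (w⁻¹ k)) h x' y' := fun H =>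
      C.enters_top S hJ hw ht ht' hp H hx'
    refine ⟨by rw [S.agree x' y' (.inl hx')]; exact H'.1, ?_⟩
    rcases H'.2 with ⟨H₁, H₂⟩ | ⟨H₁, H₂⟩
    · have e₁ := this H₁
      have e₂ := this H₂
      rw [C.u_inv_w] at e₁
      rw [hul] at e₂
      exact .inl ⟨e₁, e₂⟩
    · have e₁ := this H₁
      have e₂ := this H₂
      rw [C.u_inv_w] at e₁
      rw [hul] at e₂
      exact .inr ⟨e₁, e₂⟩
  set m := w⁻¹ l with hm
  have hwm : w m = l := by simp [hm]
  have hum : u⁻¹ l = m := by rw [← hul]; simp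
  have hub : u⁻¹ b = i := by rw [← C.u_lt_row]; simp
  have hup' : u⁻¹ (w i) = a := by rw [← C.u_corner]; simp
  have him : i < m := by
    have := hup.symm.inv_lt hB'.1 hB'.2 hlb
    rwa [hub, hum] at this
  have hpl : w i < l := by
    by_contra hcon
    have := hleft.symm.inv_lt hB'.1 hB'.2 (lt_of_le_of_ne (not_lt.1 hcon) hne.symm)
    rw [hup', hum] at this
    omega
  exact hmid m him (by omega) (hwm ▸ hpl) (hwm ▸ hlb)

end IsCornerCycle

/-- If a pipe turns north at the corner of a standard region, no pipe starts and terminates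
strictly between it and the corner. -/
theorem not_between_of_upElbow (hB : B ∈ BPD w) (S : IsStandard B w a b)
    (hp : Enters B (w i) .east a b) (m : Fin n) (him : i < m) (hma : m < a)
    (hw : w i < w m) : ¬ w m < b := by
  intro hlt
  have hJ := hB.1.isJoined
  have hX : ∀ x y, ¬ CrossAt B (w i) (w m) x y := by
    intro x y H
    have := H.inv_lt hB.1 hB.2 hw
    rw [show w⁻¹ (w i) = i by simp, show w⁻¹ (w m) = m by simp] at this
    omega
  have hT := hB.2 m
  obtain ⟨h₁, j₁, e₁, H₁, -⟩ := hT
  -- Uncrossed, `w m` stays southeast of `w i`, so on the diagonal of `(a, b)` it is in the region.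
  -- It came from below in its own column, not left of `b`, or it runs out in its row, not above
  -- `a`; both are impossible.
  obtain ⟨h₂, i₂, j₂, H₂, e₂⟩ := H₁.exists_on_diagonal ((b : ℤ) - a) (by omega) (by omega)
  have hkey := hp.edgeKey_lt_of_lt hJ hw H₂ e₂.symm fun x y H _ => hX x y H
  have hb := edgeKey_bounds h₂ j₂
  have hk : edgeKey .east b = 2 * b.val := rfl
  cases h₂ with
  | north =>
    have := S.eq_of_enters_north (by omega) (by omega) H₂
    omega
  | east =>
    have hk₂ : edgeKey .east j₂ = 2 * j₂.val := rfl
    have hT' := S.terminates_of_east hJ (by omega) (by omega)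
      ((S.hasEntry_east (by omega) (by omega) (by omega)).1 (H₂.hasEntry hJ)).le H₂
    have := hT'.row_unique (hB.2 m)
    omega

end Corner

/-! ### The permutations `w`, `v` and `u` near the corner -/

section Transition

variable {n : ℕ} {B B' : Tiling n} {f g w v u : Equiv.Perm (Fin n)}
  {a b c i : Fin n}

/-- The tiling `B` with the Rothe pipe dream of `f` put weakly southeast of `(a, b)` and the tile
`t` at `(a, b)`. -/
def replaceRegion (f : Equiv.Perm (Fin n)) (t : Tile) (a b : Fin n) (B : Tiling n) : Tiling n :=
  fun i j => if a ≤ i ∧ b ≤ j then (if i = a ∧ j = b then t else rotheTile f i j) else B i j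

theorem replaceRegion_of_lt {t : Tile} {i j : Fin n} (h : i < a ∨ j < b) :
    replaceRegion f t a b B i j = B i j := by
  unfold replaceRegion
  rw [if_neg (by omega)]

theorem replaceRegion_corner {t : Tile} : replaceRegion f t a b B a b = t := by
  simp [replaceRegion]

theorem replaceRegion_of_region {t : Tile} {i j : Fin n} (ha : a ≤ i) (hb : b ≤ j)
    (hne : a < i ∨ b < j) : replaceRegion f t a b B i j = rotheTile f i j := by
  unfold replaceRegion
  rw [if_pos ⟨ha, hb⟩, if_neg (by omega)]

/-- A tiling that agrees with the standard tiling `B` outside the region is recovered from it. -/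
theorem IsStandard.replaceRegion_eq {t : Tile} (S : IsStandard B f a b) (ht : B a b = t)
    (hB : ∀ i j, i < a ∨ j < b → B' i j = B i j) : replaceRegion f t a b B' = B := by
  funext i j
  by_cases hR : i < a ∨ j < b
  · rw [replaceRegion_of_lt hR, hB i j hR]
  · rcases eq_or_lt_of_region (show a ≤ i by omega) (show b ≤ j by omega) with ⟨rfl, rfl⟩ | hne
    · rw [replaceRegion_corner, ht]
    · rw [replaceRegion_of_region (by omega) (by omega) hne, S.tile _ _ (by omega) (by omega) hne]

theorem IsStandard.ne_blank (S : IsStandard B f a b)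
    (hD : ∀ i j, a ≤ i → b ≤ j → (i, j) ∈ rotheDiagram f → i = a ∧ j = b)
    {i j : Fin n} (ha : a ≤ i) (hb : b ≤ j) (hne : a < i ∨ b < j) : B i j ≠ .blank := by
  rw [S.tile i j ha hb hne]
  intro e
  have hmem : (i, j) ∈ rotheDiagram f := by
    unfold rotheTile at e
    split_ifs at e with h₁ h₂ h₃
    exact ⟨h₂, not_le.1 h₃⟩
  have := hD i j ha hb hmem
  omega

/-- The Rothe diagram has no cell weakly southeast of `(a, b)` other than `(a, b)`. -/
def IsClearBelow (f : Equiv.Perm (Fin n)) (a b : Fin n) : Prop :=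
  ∀ x z, a ≤ x → b ≤ f z → f z < f x → x < z → x = a ∧ f z = b

theorem IsClearBelow.diagram (H : IsClearBelow f a b) :
    ∀ i j, a ≤ i → b ≤ j → (i, j) ∈ rotheDiagram f → i = a ∧ j = b := by
  rintro i j hi hj ⟨h₁, h₂⟩
  obtain ⟨z, rfl⟩ := f.surjective j
  rw [show f⁻¹ (f z) = z by simp] at h₂
  exact H i z hi hj h₁ h₂

/-- The data of a lower outside corner `(a, b)` of the Rothe diagram of `w`, with
`v = w t_{a, c}` and `w c = b`. -/
structure IsCorner (w v : Equiv.Perm (Fin n)) (a b c : Fin n) : Prop where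
  row_lt : a < c
  w_row : w c = b
  lt_w : b < w a
  v_corner : v a = b
  v_row : v c = w a
  v_other : ∀ x, x ≠ a → x ≠ c → v x = w x
  clear_w : IsClearBelow w a b

theorem IsLowerOutsideCorner.isCorner (hab : IsLowerOutsideCorner w a b)
    (hv : v = w * Equiv.swap a (w⁻¹ b)) : IsCorner w v a b (w⁻¹ b) := by
  obtain ⟨⟨h₁, h₂⟩, hmax⟩ := hab
  simp only at h₁ h₂
  refine ⟨h₂, by simp, h₁, by simp [hv], by simp [hv], ?_, ?_⟩
  · intro x hxa hxc
    rw [hv, Equiv.Perm.mul_apply, Equiv.swap_apply_of_ne_of_ne hxa hxc]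
  · intro x z hx hz hlt hxz
    have hmem : ((x, w z) : Fin n × Fin n) ∈ rotheDiagram w := ⟨hlt, by simpa using hxz⟩
    have := hmax hmem (show (a, b) ≤ (x, w z) from ⟨hx, hz⟩)
    exact ⟨le_antisymm this.1 hx, le_antisymm this.2 hz⟩

namespace IsCorner

theorem isCornerCycle (C : IsCorner w v a b c) (hi : i < a) (hwi : w i < b) :
    IsCornerCycle w (v * Equiv.swap i a) a b c i := by
  have h₁ := C.row_lt
  refine ⟨hi, C.row_lt, C.w_row, C.lt_w, hwi, by simp [C.v_corner], ?_, ?_, ?_⟩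
  · rw [Equiv.Perm.mul_apply, Equiv.swap_apply_right, C.v_other i (by omega) (by omega)]
  · rw [Equiv.Perm.mul_apply, Equiv.swap_apply_of_ne_of_ne (by omega) (by omega), C.v_row]
  · intro x h₂ h₃ h₄
    rw [Equiv.Perm.mul_apply, Equiv.swap_apply_of_ne_of_ne h₂ h₃, C.v_other x h₃ h₄]

/-- An inversion of `v` in this range would give one of `w` in the region away from `(a, b)`: rows
other than `a` and `c` keep their values, and the value of row `c` only has to be compared with that
of row `a` in `w`. -/
theorem clear_v (C : IsCorner w v a b c) : ∀ x z, a ≤ x → b ≤ v z → v z < v x → ¬ x < z := by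
  intro x z hx hz hlt hxz
  have h₁ := C.row_lt
  have h₂ := C.lt_w
  have h₃ := C.v_corner
  have h₄ := C.v_row
  have h₅ := C.w_row
  have hxa : x ≠ a := by rintro rfl; omega
  have hza : z ≠ a := by omega
  by_cases hzc : z = c
  · subst hzc
    rw [C.v_other x hxa (by omega)] at hlt
    have := C.clear_w x z hx (by omega) (by omega) hxz
    omega
  rw [C.v_other z hza hzc] at hz hlt
  by_cases hxc : x = c
  · subst hxc
    have := C.clear_w a z le_rfl hz (by omega) (by omega)
    exact hzc (w.injective (by rw [this.2, h₅]))
  · rw [C.v_other x hxa hxc] at hlt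
    exact hxa (C.clear_w x z hx hz hlt hxz).1

end IsCorner

theorem IsCornerCycle.clear_u (C : IsCornerCycle w u a b c i) (hw : IsClearBelow w a b) :
    ∀ x z, a ≤ x → b ≤ u z → u z < u x → ¬ x < z := by
  intro x z hx hz hlt hxz
  have h₁ := C.row_lt
  have h₂ := C.lt_w
  have h₃ := C.u_corner
  have h₄ := C.u_row
  have h₅ := C.w_row
  have h₆ := C.lt_row
  have h₇ := C.w_lt
  have hxa : x ≠ a := by rintro rfl; omega
  have hza : z ≠ a := by omega
  by_cases hzc : z = c
  · subst hzc
    rw [C.u_other x (by omega) hxa (by omega)] at hlt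
    have := hw x z hx (by omega) (by omega) hxz
    omega
  rw [C.u_other z (by omega) hza hzc] at hz hlt
  by_cases hxc : x = c
  · subst hxc
    have := hw a z le_rfl hz (by omega) (by omega)
    exact hzc (w.injective (by rw [this.2, h₅]))
  · rw [C.u_other x (by omega) hxa hxc] at hlt
    exact hxa (hw x z hx hz hlt hxz).1

theorem inv_eq_of_apply {x y : Fin n} (h : f x = y) : f⁻¹ y = x := by
  rw [← h]; simp

namespace IsCorner

theorem row (C : IsCorner w v a b c) (x : Fin n) (hx : a < x) :
    v x = w x ∨ (b ≤ v x ∧ b ≤ w x) := by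
  by_cases hxc : x = c
  · subst hxc; have := C.lt_w; have := C.v_row; have := C.w_row; omega
  · exact .inl (C.v_other x (by omega) hxc)

theorem col (C : IsCorner w v a b c) (y : Fin n) (hy : b < y) :
    v⁻¹ y = w⁻¹ y ∨ (a ≤ v⁻¹ y ∧ a ≤ w⁻¹ y) := by
  obtain ⟨z, rfl⟩ := w.surjective y
  have h₁ := C.row_lt
  rw [show w⁻¹ (w z) = z by simp]
  by_cases hza : z = a
  · subst hza
    rw [inv_eq_of_apply C.v_row]; omega
  · refine .inl (inv_eq_of_apply (C.v_other z hza ?_))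
    rintro rfl
    have := C.w_row
    omega

end IsCorner

namespace IsCornerCycle

theorem row (C : IsCornerCycle w u a b c i) (x : Fin n) (hx : a < x) :
    u x = w x ∨ (b ≤ u x ∧ b ≤ w x) := by
  have h₁ := C.lt_row
  by_cases hxc : x = c
  · subst hxc; have := C.lt_w; have := C.u_row; have := C.w_row; omega
  · exact .inl (C.u_other x (by omega) (by omega) hxc)

theorem col (C : IsCornerCycle w u a b c i) (y : Fin n) (hy : b < y) :
    u⁻¹ y = w⁻¹ y ∨ (a ≤ u⁻¹ y ∧ a ≤ w⁻¹ y) := by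
  obtain ⟨z, rfl⟩ := w.surjective y
  have h₁ := C.row_lt
  have h₂ := C.w_lt
  rw [show w⁻¹ (w z) = z by simp]
  by_cases hza : z = a
  · subst hza
    rw [inv_eq_of_apply C.u_row]; omega
  · refine .inl (inv_eq_of_apply (C.u_other z ?_ hza ?_))
    · rintro rfl; omega
    · rintro rfl
      have := C.w_row
      omega

end IsCornerCycle

/-- The Rothe pipe dreams of `u` and `v` agree weakly southeast of `(a, b)` except there. -/
theorem IsCorner.rotheTile_eq (C : IsCorner w v a b c) (C' : IsCornerCycle w u a b c i)
    {x y : Fin n} (hx : a ≤ x) (hy : b ≤ y) (hne : a < x ∨ b < y) :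
    rotheTile v x y = rotheTile u x y := by
  have h₁ := C'.lt_row
  have h₂ := C'.w_lt
  have h₃ := C.v_corner
  have h₄ := C'.u_corner
  have hrow : v x = u x ∨ (v x < y ∧ u x < y) := by
    by_cases hxa : x = a
    · subst hxa; omega
    by_cases hxc : x = c
    · subst hxc; exact .inl (C.v_row.trans C'.u_row.symm)
    · exact .inl ((C.v_other x hxa hxc).trans (C'.u_other x (by omega) hxa hxc).symm)
  have hcol : v⁻¹ y = u⁻¹ y ∨ (v⁻¹ y ≤ x ∧ u⁻¹ y ≤ x) := by
    obtain ⟨z, rfl⟩ := v.surjective y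
    rw [show v⁻¹ (v z) = z by simp]
    by_cases hza : z = a
    · subst hza
      rw [h₃, inv_eq_of_apply C'.u_lt_row]
      omega
    · refine .inl (inv_eq_of_apply ?_).symm
      by_cases hzc : z = c
      · subst hzc; exact C'.u_row.trans C.v_row.symm
      · have e := C.v_other z hza hzc
        rw [e]
        refine C'.u_other z ?_ hza hzc
        rintro rfl
        omega
  have hd₁ : v x = y ↔ u x = y := by omega
  have hd₂ : y < v x ↔ y < u x := by omega
  have hd₃ : v⁻¹ y ≤ x ↔ u⁻¹ y ≤ x := by omega
  simp only [rotheTile, hd₁, hd₂, hd₃]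

end Transition

/-! ### Corner replacement in both directions -/

section Bijection

variable {n : ℕ} {B B' : Tiling n} {f w v u : Equiv.Perm (Fin n)} {a b c i : Fin n}

theorem isStandard_replaceRegion {t : Tile} (hN : t.HasEntry .north ↔ f⁻¹ b ≤ a)
    (hE : t.HasExit .east ↔ f a ≤ b) : IsStandard (replaceRegion f t a b B) f a b :=
  ⟨fun _ _ hi hj hne => replaceRegion_of_region hi hj hne, by rwa [replaceRegion_corner],
    by rwa [replaceRegion_corner]⟩

theorem replaceRegion_replaceRegion {g : Equiv.Perm (Fin n)} {s t : Tile} :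
    replaceRegion f t a b (replaceRegion g s a b B) = replaceRegion f t a b B := by
  funext i j
  unfold replaceRegion
  split_ifs <;> rfl

theorem diagram_of_clear (H : ∀ x z, a ≤ x → b ≤ f z → f z < f x → ¬ x < z) :
    ∀ i j, a ≤ i → b ≤ j → (i, j) ∉ rotheDiagram f := by
  rintro i j hi hj ⟨h₁, h₂⟩
  obtain ⟨z, rfl⟩ := f.surjective j
  rw [show f⁻¹ (f z) = z by simp] at h₂
  exact H i z hi hj h₁ h₂

/-- The rows of `φ(w, z_{a,b})`. -/
theorem IsCorner.mem_phi_iff (C : IsCorner w v a b c) (hv : v = w * Equiv.swap a (w⁻¹ b)) :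
    i ∈ phi w a b ↔ i < a ∧ w i < b ∧ ∀ m, i < m → m < a → w i < w m → ¬ w m < b := by
  have hv' : cornerSwap w a b = v := hv.symm
  have h₁ := C.row_lt
  have hvx : ∀ x, x < a → v x = w x := fun x hx => C.v_other x (by omega) (by omega)
  have key : i < a → (coxeterLength (v * Equiv.swap i a) = coxeterLength v + 1 ↔
      w i < b ∧ ∀ m, i < m → m < a → w i < w m → ¬ w m < b) := by
    intro hi
    rw [coxeterLength_mul_swap_eq_succ_iff hi, C.v_corner, hvx i hi]
    refine and_congr_right fun _ => forall_congr' fun m => forall_congr' fun _ =>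
      forall_congr' fun hm => ?_
    rw [hvx m hm]
  simp only [phi, Set.mem_ofPred_eq, hv']
  refine and_congr_right fun hi => ?_
  rw [← key hi]
  exact ⟨fun h => h.2, fun h => ⟨.single ⟨i, a, rfl, h.symm⟩, h⟩⟩

theorem IsCorner.isStandard_w (C : IsCorner w v a b c) (hB : B ∈ BPD w) : IsStandard B w a b :=
  hB.1.isJoined.isStandard hB.2 C.clear_w.diagram

theorem IsCorner.isStandard_v (C : IsCorner w v a b c) (hB : B ∈ BPD v) : IsStandard B v a b :=
  hB.1.isJoined.isStandard hB.2 fun i j hi hj h =>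
    absurd h (diagram_of_clear C.clear_v i j hi hj)

theorem IsCornerCycle.isStandard_u (C' : IsCornerCycle w u a b c i)
    (hw : IsClearBelow w a b) (hB : B ∈ BPD u) : IsStandard B u a b :=
  hB.1.isJoined.isStandard hB.2 fun i j hi hj h =>
    absurd h (diagram_of_clear (C'.clear_u hw) i j hi hj)

/-- Pipe `b` ends below row `a` and pipe `w a` starts right of column `b`, so no strand meets the
bottom or right side of the corner. -/
theorem IsCorner.corner_w (C : IsCorner w v a b c) (S : IsStandard B w a b) :
    B a b = .blank ∨ B a b = .upElbow := by
  have h₁ := S.entry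
  have h₂ := S.exit
  have h₃ := C.row_lt
  have h₄ := C.lt_w
  rw [Tile.hasEntry_north, inv_eq_of_apply C.w_row] at h₁
  rw [Tile.hasExit_east] at h₂
  have h₅ := mt h₁.1 (not_le.2 h₃)
  have h₆ := mt h₂.1 (not_le.2 h₄)
  cases hB : B a b <;> simp_all

theorem IsStandard.corner_eq (S : IsStandard B f a b) (hB : B ∈ BPD f)
    (hf : ∀ x z, a ≤ x → b ≤ f z → f z < f x → ¬ x < z) : B a b = rotheTile f a b := by
  have hr : ∀ x y, a ≤ x → b ≤ y → a < x ∨ b < y → B x y ≠ .upElbow :=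
    fun x y => S.ne_upElbow
  refine hB.1.isJoined.eq_rotheTile hB.2 hr ?_
  by_contra hbad
  exact diagram_of_clear hf a b le_rfl le_rfl (hB.1.isJoined.mem_rotheDiagram hB.2 hr hbad)

theorem IsCorner.corner_v (C : IsCorner w v a b c) (hB : B ∈ BPD v) : B a b = .downElbow := by
  rw [(C.isStandard_v hB).corner_eq hB C.clear_v, rotheTile, if_pos C.v_corner]

theorem IsCornerCycle.corner_u (C' : IsCornerCycle w u a b c i)
    (hw : IsClearBelow w a b) (hB : B ∈ BPD u) : B a b = .cross := by
  have h₁ := C'.w_lt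
  have h₂ := C'.lt_row
  rw [(C'.isStandard_u hw hB).corner_eq hB (C'.clear_u hw), rotheTile, C'.u_corner,
    inv_eq_of_apply C'.u_lt_row, if_neg h₁.ne, if_neg h₁.asymm, if_pos h₂.le]

theorem IsCorner.isStandard_replace_w (C : IsCorner w v a b c) {t : Tile}
    (ht : t = .blank ∨ t = .upElbow) : IsStandard (replaceRegion w t a b B) w a b := by
  have h₁ := C.row_lt
  have h₂ := C.lt_w
  refine isStandard_replaceRegion ?_ ?_
  · rw [Tile.hasEntry_north, inv_eq_of_apply C.w_row]
    rcases ht with rfl | rfl <;> simp [h₁]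
  · rw [Tile.hasExit_east]
    rcases ht with rfl | rfl <;> simp [h₂]

/-- The part of the bijection where the corner is blank. -/
theorem IsCorner.replace_blank_iff (C : IsCorner w v a b c) (S : IsStandard B w a b)
    (S' : IsStandard B' v a b) (hagree : ∀ i j, i < a ∨ j < b → B' i j = B i j)
    (ht : B a b = .blank) (ht' : B' a b = .downElbow) : B ∈ BPD w ↔ B' ∈ BPD v := by
  have h₁ := C.row_lt
  have hN : ¬ (B a b).HasExit .north := by rw [Tile.hasExit_north, ht]; simp
  have hS : IsSurgery B B' w v a b :=
    ⟨hagree, S, S', C.row, C.col, by rw [Tile.hasExit_north, Tile.hasExit_north, ht, ht']; simp,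
      by rw [Tile.hasEntry_east, Tile.hasEntry_east, ht, ht']; simp⟩
  have hvw : ∀ x, x < a → v x = w x := fun x hx => C.v_other x (by omega) (by omega)
  exact ⟨fun hB => hS.mem_BPD hB hvw hN (fun _ => ht') C.v_corner.ge,
    fun hB' => hS.symm.mem_BPD hB' (fun x hx => (hvw x hx).symm) (mt hS.exit.1 hN)
      (fun e => absurd e C.lt_w.ne') C.lt_w.le⟩

theorem IsCornerCycle.isSurgery (C' : IsCornerCycle w u a b c i) (S : IsStandard B w a b)
    (S' : IsStandard B' u a b) (hagree : ∀ i j, i < a ∨ j < b → B' i j = B i j)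
    (ht : B a b = .upElbow) (ht' : B' a b = .cross) : IsSurgery B B' w u a b :=
  ⟨hagree, S, S', C'.row, C'.col, by rw [Tile.hasExit_north, Tile.hasExit_north, ht, ht']; simp,
    by rw [Tile.hasEntry_east, Tile.hasEntry_east, ht, ht']; simp⟩

theorem IsCorner.replace_v_blank (C : IsCorner w v a b c) (hB : B ∈ BPD w) (ht : B a b = .blank) :
    replaceRegion v .downElbow a b B ∈ BPD v := by
  refine (C.replace_blank_iff (C.isStandard_w hB) (isStandard_replaceRegion ?_ ?_)
    (fun i j => replaceRegion_of_lt) ht replaceRegion_corner).1 hB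
  · rw [Tile.hasEntry_north, inv_eq_of_apply C.v_corner]; simp
  · rw [Tile.hasExit_east, C.v_corner]; simp

theorem IsCorner.replace_w_downElbow (C : IsCorner w v a b c) (hB : B ∈ BPD v) :
    replaceRegion w .blank a b B ∈ BPD w :=
  (C.replace_blank_iff (C.isStandard_replace_w (.inl rfl)) (C.isStandard_v hB)
    (fun _ _ h => (replaceRegion_of_lt h).symm) replaceRegion_corner (C.corner_v hB)).2 hB

theorem IsCorner.replace_v_upElbow (C : IsCorner w v a b c) (hv : v = w * Equiv.swap a (w⁻¹ b))
    (hB : B ∈ BPD w) (ht : B a b = .upElbow) :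
    ∃ i ∈ phi w a b, replaceRegion v .cross a b B ∈ BPD (v * Equiv.swap i a) := by
  have hJ := hB.1.isJoined
  have S := C.isStandard_w hB
  obtain ⟨p, hp⟩ := hJ.exists_enters (i := a) (j := b) (h := .east)
    (by rw [ht]; exact ⟨_, .upElbow⟩)
  obtain ⟨i, rfl⟩ := w.surjective p
  have hwi := hp.start_lt_of_east
  -- The pipe turns north at the corner, so it terminates strictly above row `a`.
  have hi : i < a := by
    have ha : a.val ≠ 0 := fun ha => hJ.topEdge a b ha (by rw [ht]; exact ⟨_, .upElbow⟩)
    have H : Enters B (w i) .north ⟨a.val - 1, by omega⟩ b :=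
      .north _ _ _ _ hp (by rw [ht]; exact .upElbow) (by simp only; omega)
    have := H.terminates_le (hB.2 i)
    rw [Fin.le_def] at this
    simp only at this
    omega
  have C' := C.isCornerCycle hi hwi
  refine ⟨i, (C.mem_phi_iff hv).2 ⟨hi, hwi, not_between_of_upElbow hB S hp⟩, ?_⟩
  refine C'.mem_BPD (C'.isSurgery S ⟨?_, ?_, ?_⟩ (fun i j => replaceRegion_of_lt) ht
    replaceRegion_corner) hB ht replaceRegion_corner hp
  · intro x y hx hy hne
    rw [replaceRegion_of_region hx hy hne, C.rotheTile_eq C' hx hy hne]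
  · rw [replaceRegion_corner, Tile.hasEntry_north, inv_eq_of_apply C'.u_lt_row]
    simp [hi.le]
  · rw [replaceRegion_corner, Tile.hasExit_east, C'.u_corner]
    simp [hwi.le]

theorem IsCorner.replace_w_cross (C : IsCorner w v a b c) (hv : v = w * Equiv.swap a (w⁻¹ b))
    (hi : i ∈ phi w a b) (hB : B ∈ BPD (v * Equiv.swap i a)) :
    B a b = .cross ∧ replaceRegion w .upElbow a b B ∈ BPD w ∧
      replaceRegion v .cross a b B = B := by
  obtain ⟨hi, hwi, hmid⟩ := (C.mem_phi_iff hv).1 hi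
  have C' := C.isCornerCycle hi hwi
  have S' := C'.isStandard_u C.clear_w hB
  have ht := C'.corner_u C.clear_w hB
  refine ⟨ht, C'.mem_BPD_symm (C'.isSurgery (C.isStandard_replace_w (.inr rfl)) S'
    (fun _ _ h => (replaceRegion_of_lt h).symm) replaceRegion_corner ht) hB
      replaceRegion_corner ht hmid, ?_⟩
  rw [← S'.replaceRegion_eq ht fun _ _ _ => rfl]
  funext x y
  by_cases hR : x < a ∨ y < b
  · simp only [replaceRegion_of_lt hR]
  · rcases eq_or_lt_of_region (show a ≤ x by omega) (show b ≤ y by omega) with ⟨rfl, rfl⟩ | hne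
    · simp only [replaceRegion_corner]
    · rw [replaceRegion_of_region (by omega) (by omega) hne,
        replaceRegion_of_region (by omega) (by omega) hne,
        C.rotheTile_eq C' (by omega) (by omega) hne]

/-- The new corner tile: a pipe that turned north at the corner now crosses another one. -/
def Tile.cornerForward : Tile → Tile
  | .upElbow => .cross
  | _ => .downElbow

/-- The inverse of `Tile.cornerForward` on the tiles that occur at the corner. -/
def Tile.cornerBackward : Tile → Tile
  | .cross => .upElbow
  | _ => .blank

theorem IsCorner.diagram_replaceRegion (C : IsCorner w v a b c) (hB : B ∈ BPD w) {t : Tile}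
    {x y : Fin n} (hne : (x, y) ≠ (a, b)) :
    (x, y) ∈ diagram B ↔ (x, y) ∈ diagram (replaceRegion v t a b B) := by
  change B x y = .blank ↔ replaceRegion v t a b B x y = .blank
  by_cases hR : x < a ∨ y < b
  · rw [replaceRegion_of_lt hR]
  have hx : a ≤ x := by omega
  have hy : b ≤ y := by omega
  rcases eq_or_lt_of_region hx hy with ⟨rfl, rfl⟩ | hne'
  · exact absurd rfl hne
  · refine iff_of_false ((C.isStandard_w hB).ne_blank C.clear_w.diagram hx hy hne') ?_
    rw [replaceRegion_of_region hx hy hne']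
    intro e
    unfold rotheTile at e
    split_ifs at e with h₁ h₂ h₃
    exact diagram_of_clear C.clear_v x y hx hy ⟨h₂, not_le.1 h₃⟩

end Bijection

end Bumpless

/-! ### The bijection and its effect on diagrams -/

theorem mainTheorem8 (n : ℕ) (w v : Equiv.Perm (Fin n)) (a b : Fin n)
    (hab : Bumpless.IsLowerOutsideCorner w a b)
    (hv : v = w * Equiv.swap a (w⁻¹ b)) :
    ∃ ψ : ↥(Bumpless.BPD w) →
        ↥(Bumpless.BPD v ∪ ⋃ u ∈ Bumpless.Phi w a b, Bumpless.BPD u),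
      Function.Bijective ψ ∧
      ∀ B : ↥(Bumpless.BPD w),
        ((ψ B).1 ∈ Bumpless.BPD v →
          Disjoint (Bumpless.diagram (ψ B).1) {(a, b)} ∧
            Bumpless.diagram B.1 = Bumpless.diagram (ψ B).1 ∪ {(a, b)}) ∧
        ((ψ B).1 ∉ Bumpless.BPD v →
          Bumpless.diagram B.1 = Bumpless.diagram (ψ B).1) := by
  open Bumpless in
  have C := hab.isCorner hv
  -- The filling for `v` also serves every `u ∈ Φ`, so `F` need not know `i`; the corner tile alone
  -- tells `G` which case to undo.
  let F : Tiling n → Tiling n := fun B => replaceRegion v (B a b).cornerForward a b B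
  let G : Tiling n → Tiling n := fun B => replaceRegion w (B a b).cornerBackward a b B
  have hphi : ∀ u, u ∈ Phi w a b ↔ ∃ i ∈ phi w a b, u = v * Equiv.swap i a := by
    intro u
    rw [show v = cornerSwap w a b from hv]
    rfl
  have hF : ∀ B ∈ BPD w, F B ∈ BPD v ∪ ⋃ u ∈ Phi w a b, BPD u := by
    intro B hB
    rcases C.corner_w (C.isStandard_w hB) with ht | ht
    · left
      simp only [F, ht, Tile.cornerForward]
      exact C.replace_v_blank hB ht
    · right
      simp only [F, ht, Tile.cornerForward]
      obtain ⟨i, hi, hmem⟩ := C.replace_v_upElbow hv hB ht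
      exact Set.mem_biUnion ((hphi _).2 ⟨i, hi, rfl⟩) hmem
  have hG : ∀ B ∈ BPD v ∪ ⋃ u ∈ Phi w a b, BPD u, G B ∈ BPD w ∧ F (G B) = B := by
    rintro B (hB | hB)
    · have ht := C.corner_v hB
      refine ⟨?_, ?_⟩
      · simp only [G, ht, Tile.cornerBackward]
        exact C.replace_w_downElbow hB
      · simp only [F, G, ht, Tile.cornerBackward, replaceRegion_corner, Tile.cornerForward]
        exact (C.isStandard_v hB).replaceRegion_eq ht fun _ _ => replaceRegion_of_lt
    · obtain ⟨u, hu, hB⟩ := Set.mem_iUnion₂.1 hB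
      obtain ⟨i, hi, rfl⟩ := (hphi u).1 hu
      obtain ⟨ht, h₁, h₂⟩ := C.replace_w_cross hv hi hB
      refine ⟨?_, ?_⟩
      · simp only [G, ht, Tile.cornerBackward]
        exact h₁
      · simp only [F, G, ht, Tile.cornerBackward, replaceRegion_corner, Tile.cornerForward]
        rwa [replaceRegion_replaceRegion]
  have hGF : ∀ B ∈ BPD w, G (F B) = B := by
    intro B hB
    have S := C.isStandard_w hB
    refine S.replaceRegion_eq ?_ fun _ _ => replaceRegion_of_lt
    rcases C.corner_w S with ht | ht <;>
      simp only [F, ht, Tile.cornerForward, replaceRegion_corner, Tile.cornerBackward]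
  refine ⟨fun B => ⟨F B.1, hF B.1 B.2⟩, ⟨?_, ?_⟩, ?_⟩
  · intro B₁ B₂ e
    have e' : F B₁.1 = F B₂.1 := congrArg Subtype.val e
    exact Subtype.ext (by rw [← hGF _ B₁.2, ← hGF _ B₂.2, e'])
  · intro B
    exact ⟨⟨G B.1, (hG B.1 B.2).1⟩, Subtype.ext (hG B.1 B.2).2⟩
  · rintro ⟨B, hB⟩
    have hFab : F B a b = (B a b).cornerForward := replaceRegion_corner
    have hne : (B a b).cornerForward ≠ .blank := by
      cases B a b <;> simp [Tile.cornerForward]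
    have hmem : (a, b) ∉ diagram (F B) := fun e => hne (hFab.symm.trans e)
    have hd : ∀ p, p ≠ (a, b) → (p ∈ diagram B ↔ p ∈ diagram (F B)) := fun p hp =>
      C.diagram_replaceRegion hB hp
    simp only
    rcases C.corner_w (C.isStandard_w hB) with ht | ht
    · have hFv : F B ∈ BPD v := by
        simp only [F, ht, Tile.cornerForward]
        exact C.replace_v_blank hB ht
      refine ⟨fun _ => ⟨Set.disjoint_singleton_right.2 hmem, ?_⟩, fun h => absurd hFv h⟩
      ext p
      by_cases hp : p = (a, b)
      · subst hp; exact iff_of_true ht (.inr rfl)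
      · rw [hd p hp, Set.mem_union, Set.mem_singleton_iff]; simp [hp]
    · refine ⟨fun h => ?_, fun _ => ?_⟩
      -- Pipe dreams of `v` have a down-elbow at the corner, whereas `F` has put a crossing there.
      · have := C.corner_v h
        rw [hFab, ht] at this
        simp [Tile.cornerForward] at this
      · ext p
        by_cases hp : p = (a, b)
        · subst hp
          refine iff_of_false (fun e => ?_) hmem
          rw [show B a b = .blank from e] at ht
          simp at ht
        · exact hd p hp
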